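/- Let $d\ge 1$, $\lambda>0$, $\alpha>d$, $\theta>0$, $W>0$, $N_0\ge 0$ and $N\ge 2$. A receiver sits at the origin of $\mathbb{R}^d$, its desired transmitter at a point $x_0$ with $r_0=|x_0|>0$, and the interfering transmitters form a homogeneous Poisson point process of intensity $\lambda$ on $\mathbb{R}^d$; $\Phi$ denotes the collection of all these transmitters. In each time slot $k$ every transmitter $x$ has a fading coefficient $h_{k,x}$ and uses a sub-band $\mathcal{S}_k(x)\in\{1,\dots,N\}$ (frequency-hopping multiple access, FHMA, with $N$ sub-bands); the $h_{k,x}$ are i.i.d. exponential with mean $1$, the $\mathcal{S}_k(x)$ are i.i.d. uniform, and locations, fading and sub-bands are independent. Slot $k$ is successful if $$\mathrm{SINR}_k=\frac{h_{k,x_0}r_0^{-\alpha}}{\frac{WN_0}{N}+\sum_{x\in\Phi\setminus\{x_0\}}h_{k,x}|x|^{-\alpha}\mathbf 1(\mathcal{S}_k(x)=\mathcal{S}_k(x_0))}>\theta .$$ The local delay is the number of time slots until $N$ slots have been successful; it is the sum of the $N$ successive delays till success (the first counted from the start, each later one from the preceding success). Then the conditional probability $p(\Phi)$, given the locations of the transmitters,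 that a slot is successful is almost surely positive and does not depend on the slot; given these locations, the $N$ delays till success are i.i.d. geometric on $\{1,2,\dots\}$ with parameter $p(\Phi)$; and the local delay is almost surely finite with finite second moment. Put $\delta=d/\alpha$, $A=\lambda c_d r_0^d\theta^{\delta}\,\frac{\pi\delta}{\sin(\pi\delta)}$, where $c_d$ is the volume of the unit ball of $\mathbb{R}^d$, and $B=\theta r_0^{\alpha}WN_0$. The mean of the local delay is $$D(N)=N\exp\Big(\frac{A}{(N-1)^{1-\delta}N^{\delta}}+\frac{B}{N}\Big)$$ and its variance is $$V(N)=N(N+1)\exp\Big(\frac{(2N-1-\delta)A}{N^{\delta}(N-1)^{2-\delta}}+\frac{2B}{N}\Big)-D(N)-D(N)^2 .$$ -/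

import Mathlib

open MeasureTheory ProbabilityTheory
open scoped ENNReal

namespace FHMA

noncomputable section

/-- Number of points (of the family `X` of random points) that fall in the set `B`. -/
def pointCount {Ω E : Type*} (X : ℕ → Ω → E) (B : Set E) (ω : Ω) : ℕ∞ :=
  Set.encard {i : ℕ | X i ω ∈ B}

/-- The random points `X 0, X 1, …` enumerate a homogeneous Poisson point process of intensity
`lam` on `ℝ^d`: the number of points in a Borel set of finite volume is Poisson distributed with
mean `lam * volume`, and the numbers of points in disjoint such sets are independent.
(For `d ≥ 1` and `lam > 0` such a process has infinitely many points almost surely, so that it can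
be enumerated by `ℕ`; the order of enumeration is arbitrary.) -/
structure IsPoissonProcess {Ω : Type*} [MeasurableSpace Ω] (P : Measure Ω) {d : ℕ} (lam : ℝ)
    (X : ℕ → Ω → EuclideanSpace ℝ (Fin d)) : Prop where
  measurable : ∀ i, Measurable (X i)
  poisson : ∀ B : Set (EuclideanSpace ℝ (Fin d)), MeasurableSet B → volume B ≠ ∞ → ∀ n : ℕ,
    P {ω | pointCount X B ω = n} =
      ENNReal.ofReal (Real.exp (-(lam * volume.real B)) * (lam * volume.real B) ^ n / n.factorial)
  indep : ∀ (m : ℕ) (B : Fin m → Set (EuclideanSpace ℝ (Fin d))),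
    (∀ j, MeasurableSet (B j)) → (∀ j, volume (B j) ≠ ∞) →
    (∀ j j', j ≠ j' → Disjoint (B j) (B j')) →
    iIndepFun (fun j => pointCount X (B j)) P

/-- The random elements of a Poisson bipolar network with frequency-hopping multiple access over
`N` sub-bands, seen from the typical receiver at the origin (that is, conditioned on a transmitter
at the desired location, which amounts to adding that transmitter to the Poisson process).
* `X i` is the location of the `i`-th interferer; the interferers form a Poisson process.
* Transmitters are indexed by `Option ℕ`: `none` is the desired transmitter and `some i` is the
  `i`-th interferer.
* `h k x` is the power fading coefficient from transmitter `x` in time slot `k`; these are i.i.d.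
  exponential with unit mean.
* `S k x` is the sub-band used by transmitter `x` in time slot `k`; these are i.i.d. uniform.
The locations, the fading and the sub-bands are mutually independent. -/
structure IsNetwork {Ω : Type*} [MeasurableSpace Ω] (P : Measure Ω) {d : ℕ} (lam : ℝ) {N : ℕ}
    (X : ℕ → Ω → EuclideanSpace ℝ (Fin d)) (h : ℕ → Option ℕ → Ω → ℝ)
    (S : ℕ → Option ℕ → Ω → Fin N) : Prop where
  isPoissonProcess : IsPoissonProcess P lam X
  measurable_fading : ∀ k x, Measurable (h k x)
  fading_law : ∀ k x, P.map (h k x) = expMeasure 1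
  fading_iIndep : iIndepFun (fun p : ℕ × Option ℕ => h p.1 p.2) P
  measurable_band : ∀ k x, Measurable (S k x)
  band_law : ∀ k x (s : Fin N), P {ω | S k x ω = s} = (N : ℝ≥0∞)⁻¹
  band_iIndep : iIndepFun (fun p : ℕ × Option ℕ => S p.1 p.2) P
  fading_band_indep : IndepFun (fun ω (p : ℕ × Option ℕ) => h p.1 p.2 ω)
    (fun ω (p : ℕ × Option ℕ) => S p.1 p.2 ω) P
  locations_indep : IndepFun (fun ω i => X i ω)
    (fun ω (p : ℕ × Option ℕ) => (h p.1 p.2 ω, S p.1 p.2 ω)) P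

/-- Normalized interference power at the origin in time slot `k`, with path loss `r ^ (-α)`: the sum
over the interferers which use the sub-band of the desired transmitter. -/
def interference {Ω : Type*} {d N : ℕ} (α : ℝ) (X : ℕ → Ω → EuclideanSpace ℝ (Fin d))
    (h : ℕ → Option ℕ → Ω → ℝ) (S : ℕ → Option ℕ → Ω → Fin N) (k : ℕ) (ω : Ω) : ℝ≥0∞ :=
  ∑' i : ℕ, if S k (some i) ω = S k none ω then
    ENNReal.ofReal (h k (some i) ω) * ‖X i ω‖ₑ ^ (-α) else 0

/-- Signal to interference and noise ratio at the origin in time slot `k`, for a desired transmitter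
at distance `r₀`, total bandwidth `W` and normalized noise power spectral density `N₀`. -/
def sinr {Ω : Type*} {d N : ℕ} (α r₀ W N₀ : ℝ) (X : ℕ → Ω → EuclideanSpace ℝ (Fin d))
    (h : ℕ → Option ℕ → Ω → ℝ) (S : ℕ → Option ℕ → Ω → Fin N) (k : ℕ) (ω : Ω) : ℝ≥0∞ :=
  ENNReal.ofReal (h k none ω * r₀ ^ (-α)) /
    (ENNReal.ofReal (W * N₀ / N) + interference α X h S k ω)

/-- The set of the time slots (numbered from `0`) in which the transmission succeeds. -/
def successSlots {Ω : Type*} {d N : ℕ} (α θ r₀ W N₀ : ℝ) (X : ℕ → Ω → EuclideanSpace ℝ (Fin d))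
    (h : ℕ → Option ℕ → Ω → ℝ) (S : ℕ → Option ℕ → Ω → Fin N) (ω : Ω) : Set ℕ :=
  {k | ENNReal.ofReal θ < sinr α r₀ W N₀ X h S k ω}

/-- The number of time slots needed until `j` of the slots in `A` have occurred: the least `n` such
that at least `j` of the first `n` slots are in `A` (and `⊤` if there is none). -/
def slotsUntil (A : Set ℕ) (j : ℕ) : ℕ∞ :=
  ⨅ (n : ℕ) (_ : j ≤ (A ∩ Set.Iio n).ncard), (n : ℕ∞)

/-- The local delay of a packet in FHMA with `N` sub-bands: the number of time slots needed until
`N` transmissions have succeeded. -/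
def localDelay {Ω : Type*} {d N : ℕ} (α θ r₀ W N₀ : ℝ) (X : ℕ → Ω → EuclideanSpace ℝ (Fin d))
    (h : ℕ → Option ℕ → Ω → ℝ) (S : ℕ → Option ℕ → Ω → Fin N) (ω : Ω) : ℕ∞ :=
  slotsUntil (successSlots α θ r₀ W N₀ X h S ω) N

/-- The `i`-th delay till success (`i = 0, 1, …`): the number of time slots used after the `i`-th
success up to and including the next one (counted from the start for `i = 0`). -/
def delayTillSuccess {Ω : Type*} {d N : ℕ} (α θ r₀ W N₀ : ℝ)
    (X : ℕ → Ω → EuclideanSpace ℝ (Fin d))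
    (h : ℕ → Option ℕ → Ω → ℝ) (S : ℕ → Option ℕ → Ω → Fin N) (i : ℕ) (ω : Ω) : ℕ∞ :=
  slotsUntil (successSlots α θ r₀ W N₀ X h S ω) (i + 1) -
    slotsUntil (successSlots α θ r₀ W N₀ X h S ω) i

/-- The σ-algebra generated by the locations of the transmitters. -/
abbrev locationsSigma {Ω : Type*} {d : ℕ} (X : ℕ → Ω → EuclideanSpace ℝ (Fin d)) :
    MeasurableSpace Ω :=
  MeasurableSpace.comap (fun ω i => X i ω) inferInstance

/-- The conditional probability, given the locations of the transmitters, that the transmission in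
time slot `k` succeeds. -/
def condSuccess {Ω : Type*} [MeasurableSpace Ω] (P : Measure Ω) {d N : ℕ} (α θ r₀ W N₀ : ℝ)
    (X : ℕ → Ω → EuclideanSpace ℝ (Fin d))
    (h : ℕ → Option ℕ → Ω → ℝ) (S : ℕ → Option ℕ → Ω → Fin N) (k : ℕ) : Ω → ℝ :=
  P⟦{ω | k ∈ successSlots α θ r₀ W N₀ X h S ω} | locationsSigma X⟧

/-- `A = λ c_d r₀^d θ^δ C(δ)` with `δ = d / α`, `c_d` the volume of the unit ball of `ℝ^d` and
`C(δ) = 1 / sinc δ` for the normalized `sinc δ = sin (π δ) / (π δ)`. -/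
def paramA (d : ℕ) (lam α θ r₀ : ℝ) : ℝ :=
  lam * volume.real (Metric.ball (0 : EuclideanSpace ℝ (Fin d)) 1) * r₀ ^ d * θ ^ (d / α) *
    (1 / Real.sinc (Real.pi * (d / α)))

/-- `B = θ r₀^α W N₀`. -/
def paramB (α θ r₀ W N₀ : ℝ) : ℝ :=
  θ * r₀ ^ α * W * N₀

/-- The closed form `D(N)` of the mean local delay. -/
def meanFormula (d N : ℕ) (lam α θ r₀ W N₀ : ℝ) : ℝ :=
  N * Real.exp (paramA d lam α θ r₀ / (((N : ℝ) - 1) ^ (1 - d / α) * (N : ℝ) ^ (d / α)) +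
    paramB α θ r₀ W N₀ / N)

/-- The closed form `V(N)` of the variance of the local delay. -/
def varFormula (d N : ℕ) (lam α θ r₀ W N₀ : ℝ) : ℝ :=
  N * ((N : ℝ) + 1) *
    Real.exp ((2 * (N : ℝ) - 1 - d / α) * paramA d lam α θ r₀ /
        ((N : ℝ) ^ (d / α) * ((N : ℝ) - 1) ^ (2 - d / α)) +
      2 * paramB α θ r₀ W N₀ / N) -
    meanFormula d N lam α θ r₀ W N₀ - meanFormula d N lam α θ r₀ W N₀ ^ 2

end

end FHMA

/-! Put `c = θ * r₀ ^ α` and freeze the locations `x i`. Slot `k` succeeds exactly when the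
exponential variable `h k none` exceeds `c` times noise plus interference, so its success
probability is the Laplace transform of noise plus interference at `c`. An interferer shares the
desired band with probability `1/N` and then contributes `(1 + c‖x‖^(-α))⁻¹`. Independence over
interferers gives `p = e^(-B/N) ∏ v (x i)` with `v = bandLaplace` (`IsNetwork.measure_success`).

Different slots involve disjoint groups of marks, so given the locations the successes are
independent trials with the same `p`. The waiting times are therefore i.i.d. geometric
(`measure_waiting_times`) and the local delay `L` is negative binomial, with conditional moments `E
L = N/p` and `E L(L+1) = N(N+1)/p²`. The mean and the variance thus reduce to `E p⁻¹` and `E p⁻²`.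

Since `p⁻ʲ` is the exponential of a sum over the Poisson points,
`IsPoissonProcess.lintegral_expE_tsum` gives `E p⁻ʲ = exp (jB/N + λ ∫ (v⁻ʲ - 1))`. For `j = 1, 2`
the integrand is a combination of terms `‖x‖^β (1 + b‖x‖^α)^(-m)`; polar coordinates turn these into
beta integrals, and Euler's reflection formula for `Γ(δ)Γ(1-δ)` produces the sinc factor.
Convergence uses `d < α` and `N ≥ 2`. Finiteness of `E p⁻¹` also shows that `p > 0` almost surely.

Most expectations are taken in `[0, ∞]`, with `expE` and `logE` extended there: infinite
interference or `p = 0` then needs no separate treatment, and integrability comes out at the end. -/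

namespace FHMA

/-! ### The exponential function on `[0, ∞]` -/

/-- The exponential function on `[0, ∞]`. -/
noncomputable def expE (t : ℝ≥0∞) : ℝ≥0∞ := EReal.exp t

lemma continuous_expE : Continuous expE :=
  ENNReal.continuous_exp.comp continuous_coe_ennreal_ereal

lemma measurable_expE : Measurable expE := continuous_expE.measurable

lemma expE_mono : Monotone expE := fun _ _ h =>
  EReal.exp_monotone (EReal.coe_ennreal_le_coe_ennreal_iff.2 h)

@[simp] lemma expE_zero : expE 0 = 1 := by simp [expE]

@[simp] lemma expE_top : expE ⊤ = ⊤ := by simp [expE]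

lemma expE_add (s t : ℝ≥0∞) : expE (s + t) = expE s * expE t := by
  simp [expE, EReal.exp_add]

lemma expE_ofReal {x : ℝ} (hx : 0 ≤ x) : expE (ENNReal.ofReal x) = ENNReal.ofReal (Real.exp x) := by
  simp [expE, EReal.coe_ennreal_ofReal, max_eq_left hx]

lemma one_le_expE (t : ℝ≥0∞) : 1 ≤ expE t := by
  simp [expE, EReal.coe_ennreal_nonneg]

lemma expE_ne_zero (t : ℝ≥0∞) : expE t ≠ 0 := (zero_lt_one.trans_le (one_le_expE t)).ne'

@[simp] lemma expE_eq_top {t : ℝ≥0∞} : expE t = ⊤ ↔ t = ⊤ := by simp [expE]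

lemma expE_sum {ι : Type*} (s : Finset ι) (f : ι → ℝ≥0∞) :
    expE (∑ i ∈ s, f i) = ∏ i ∈ s, expE (f i) := by
  classical
  induction s using Finset.induction_on with
  | empty => simp
  | insert a s ha ih => rw [Finset.sum_insert ha, Finset.prod_insert ha, expE_add, ih]

lemma expE_nat_mul (n : ℕ) (t : ℝ≥0∞) : expE (n * t) = expE t ^ n := by
  induction n with
  | zero => simp
  | succ n ih => rw [Nat.cast_succ, add_mul, one_mul, expE_add, ih, pow_succ]

/-- The logarithm on `[1, ∞]`, with values in `[0, ∞]`. -/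
noncomputable def logE (w : ℝ≥0∞) : ℝ≥0∞ := (ENNReal.log w).toENNReal

lemma measurable_logE : Measurable logE :=
  measurable_ereal_toENNReal.comp ENNReal.measurable_log

lemma expE_logE {w : ℝ≥0∞} (hw : 1 ≤ w) : expE (logE w) = w := by
  rw [expE, logE, EReal.coe_toENNReal (by simpa using hw), ENNReal.exp_log]

/-! ### Extended natural valued random variables -/

section ENat

variable {Ω : Type*} [MeasurableSpace Ω] {P : Measure Ω} [IsProbabilityMeasure P]

lemma ae_ne_top_of_tsum_eq_one {L : Ω → ℕ∞} (hL : Measurable L)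
    (h1 : ∑' n : ℕ, P {ω | L ω = n} = 1) : ∀ᵐ ω ∂P, L ω ≠ ⊤ := by
  have hU : (⋃ n : ℕ, {ω | L ω = n}) = {ω | L ω ≠ ⊤} := by
    ext ω
    simp only [Set.mem_iUnion, Set.mem_ofPred_eq]
    constructor
    · rintro ⟨n, hn⟩
      simp [hn]
    · intro h
      exact ⟨(L ω).toNat, (ENat.natCast_toNat h).symm⟩
  have hm : ∀ n : ℕ, MeasurableSet {ω | L ω = n} := fun n => hL (measurableSet_singleton _)
  rw [← measure_iUnion, hU] at h1
  · rwa [ae_iff, ← Set.compl_ofPred, prob_compl_eq_zero_iff]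
    exact hL (Set.to_countable {x : ℕ∞ | x ≠ ⊤}).measurableSet
  · intro i j hij
    rw [Function.onFun, Set.disjoint_left]
    intro ω hi hj
    simp only [Set.mem_ofPred_eq] at hi hj
    exact hij (by exact_mod_cast hi.symm.trans hj)
  · exact hm

/-- Masses at the finite values that add up to one leave none at `⊤`, so the value `F ⊤` plays no
role. -/
lemma lintegral_enat {L : Ω → ℕ∞} (hL : Measurable L)
    (h1 : ∑' n : ℕ, P {ω | L ω = n} = 1) (F : ℕ∞ → ℝ≥0∞) :
    ∫⁻ ω, F (L ω) ∂P = ∑' n : ℕ, F n * P {ω | L ω = n} := by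
  have htop := ae_ne_top_of_tsum_eq_one hL h1
  have hK : Measurable fun ω => (L ω).toNat := (measurable_of_countable ENat.toNat).comp hL
  calc ∫⁻ ω, F (L ω) ∂P = ∫⁻ ω, F ((L ω).toNat : ℕ∞) ∂P := by
        refine lintegral_congr_ae ?_
        filter_upwards [htop] with ω hω
        rw [ENat.natCast_toNat hω]
    _ = ∫⁻ n : ℕ, F n ∂(P.map fun ω => (L ω).toNat) := by
        rw [lintegral_map (measurable_of_countable _) hK]
    _ = ∑' n : ℕ, F n * P {ω | L ω = n} := by
        rw [lintegral_countable']
        congr 1 with n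
        rw [Measure.map_apply hK (measurableSet_singleton _)]
        congr 1
        refine measure_congr ?_
        filter_upwards [htop] with ω hω
        refine propext ?_
        change (L ω).toNat = n ↔ L ω = n
        constructor
        · rintro rfl
          rw [ENat.natCast_toNat hω]
        · intro h
          simp [h]

/-- The exponential moments of a Poisson random variable. -/
lemma lintegral_expE_of_poisson {L : Ω → ℕ∞} (hL : Measurable L) {r : ℝ} (hr : 0 ≤ r)
    (h : ∀ n : ℕ, P {ω | L ω = n} = ENNReal.ofReal (Real.exp (-r) * r ^ n / n.factorial))
    {c : ℝ≥0∞} (hc : c ≠ ⊤) :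
    ∫⁻ ω, expE (c * (L ω : ℝ≥0∞)) ∂P = expE (ENNReal.ofReal r * (expE c - 1)) := by
  have hs : ∀ x : ℝ, HasSum (fun n : ℕ => x ^ n / n.factorial) (Real.exp x) := fun x => by
    rw [Real.exp_eq_exp_ℝ]; exact NormedSpace.expSeries_div_hasSum_exp x
  have key : ∀ x : ℝ, 0 ≤ x → ∑' n : ℕ, ENNReal.ofReal (x ^ n / n.factorial) =
      ENNReal.ofReal (Real.exp x) := fun x hx => by
    rw [← (hs x).tsum_eq, ENNReal.ofReal_tsum_of_nonneg (fun n => by positivity) (hs x).summable]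
  have h1 : ∑' n : ℕ, P {ω | L ω = n} = 1 := by
    simp_rw [h, mul_div_assoc, ENNReal.ofReal_mul (Real.exp_nonneg _)]
    rw [ENNReal.tsum_mul_left, key r hr, ← ENNReal.ofReal_mul (Real.exp_nonneg _), ← Real.exp_add]
    simp
  rw [lintegral_enat hL h1 fun n => expE (c * (n : ℝ≥0∞))]
  obtain ⟨a, ha, rfl⟩ : ∃ a : ℝ, 0 ≤ a ∧ ENNReal.ofReal a = c :=
    ⟨c.toReal, ENNReal.toReal_nonneg, ENNReal.ofReal_toReal hc⟩
  have h2 : ∀ n : ℕ, expE (ENNReal.ofReal a * ((n : ℕ∞) : ℝ≥0∞)) * P {ω | L ω = n} =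
      ENNReal.ofReal (Real.exp (-r)) * ENNReal.ofReal ((r * Real.exp a) ^ n / n.factorial) := by
    intro n
    rw [h, ENat.toENNReal_coe, mul_comm (ENNReal.ofReal a), expE_nat_mul,
      expE_ofReal ha, ← ENNReal.ofReal_pow (Real.exp_nonneg _),
      ← ENNReal.ofReal_mul (by positivity), ← ENNReal.ofReal_mul (by positivity)]
    congr 1
    rw [mul_pow]; ring
  simp_rw [h2]
  rw [ENNReal.tsum_mul_left, key _ (by positivity), ← ENNReal.ofReal_mul (by positivity),
    ← Real.exp_add, expE_ofReal ha, ← ENNReal.ofReal_one, ← ENNReal.ofReal_sub _ zero_le_one,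
    ← ENNReal.ofReal_mul hr, expE_ofReal]
  · congr 2; ring
  · exact mul_nonneg hr (sub_nonneg.2 (Real.one_le_exp ha))

end ENat

/-! ### The exponential functional of a Poisson process -/

section Poisson

variable {Ω : Type*} [MeasurableSpace Ω] {P : Measure Ω} [IsProbabilityMeasure P]
  {d : ℕ} {lam : ℝ} {X : ℕ → Ω → EuclideanSpace ℝ (Fin d)}

lemma toENNReal_pointCount {Ω E : Type*} (X : ℕ → Ω → E) (B : Set E) (ω : Ω) :
    (pointCount X B ω : ℝ≥0∞) = ∑' i, B.indicator (fun _ => (1 : ℝ≥0∞)) (X i ω) := by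
  rw [pointCount, ← ENNReal.tsum_set_one, tsum_subtype {i | X i ω ∈ B} fun _ => (1 : ℝ≥0∞)]
  rfl

lemma measurable_pointCount {E : Type*} [MeasurableSpace E] {X : ℕ → Ω → E}
    (hX : ∀ i, Measurable (X i)) {B : Set E} (hB : MeasurableSet B) :
    Measurable (pointCount X B) := by
  have h : Measurable fun ω => (pointCount X B ω : ℝ≥0∞) := by
    simp_rw [toENNReal_pointCount]
    exact Measurable.tsum fun i => (measurable_const.indicator hB).comp (hX i)
  -- `ℕ∞` is countable and embeds injectively in `[0, ∞]`, so measurability can be tested on fibres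
  -- of the extended real valued count.
  refine measurable_to_countable' fun n => ?_
  have : pointCount X B ⁻¹' {n} = (fun ω => (pointCount X B ω : ℝ≥0∞)) ⁻¹' {(n : ℝ≥0∞)} := by
    ext ω
    simp
  rw [this]
  exact h (measurableSet_singleton _)

lemma tsum_simpleFunc_eq_sum_pointCount {Ω E : Type*} [MeasurableSpace E] (X : ℕ → Ω → E)
    (f : SimpleFunc E ℝ≥0∞) (ω : Ω) :
    ∑' i, f (X i ω) = ∑ c ∈ f.range, c * (pointCount X (f ⁻¹' {c}) ω : ℝ≥0∞) := by
  simp_rw [toENNReal_pointCount, ← ENNReal.tsum_mul_left]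
  rw [← Summable.tsum_finsetSum fun _ _ => ENNReal.summable]
  congr 1 with i
  rw [Finset.sum_eq_single (f (X i ω))]
  · simp
  · intro c _ hc
    simp [Set.indicator, Ne.symm hc]
  · intro h
    exact absurd (SimpleFunc.mem_range_self f _) h

/-- The sum over the points is a combination of the counts in the level sets of `f`. These sets are
disjoint, so the counts are independent Poisson variables and the expectation factorizes into
Poisson exponential moments. -/
lemma IsPoissonProcess.lintegral_expE_simpleFunc (hX : IsPoissonProcess P lam X) (hlam : 0 ≤ lam)
    (f : SimpleFunc (EuclideanSpace ℝ (Fin d)) ℝ≥0∞) (hf : ∀ x, f x ≠ ⊤)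
    (hsupp : volume (Function.support f) ≠ ⊤) :
    ∫⁻ ω, expE (∑' i, f (X i ω)) ∂P =
      expE (ENNReal.ofReal lam * ∫⁻ x, (expE (f x) - 1)) := by
  classical
  -- The level set of `0` may have infinite volume, where the Poisson law says nothing; it
  -- contributes nothing and is dropped.
  set s : Finset ℝ≥0∞ := f.range.filter (· ≠ 0) with hs
  have hmem : ∀ c ∈ s, c ≠ 0 ∧ c ≠ ⊤ := by
    intro c hc
    obtain ⟨h1, h2⟩ := Finset.mem_filter.1 hc
    obtain ⟨x, rfl⟩ := SimpleFunc.mem_range.1 h1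
    exact ⟨h2, hf x⟩
  have hvol : ∀ c ∈ s, volume (f ⁻¹' {c}) ≠ ⊤ := fun c hc => by
    refine measure_ne_top_of_subset ?_ hsupp
    rintro x hx
    simp only [Set.mem_preimage, Set.mem_singleton_iff] at hx
    simpa [hx] using (hmem c hc).1
  let e := s.equivFin
  have hind : iIndepFun (fun (c : s) => pointCount X (f ⁻¹' {c.1})) P := by
    have := hX.indep s.card (fun j => f ⁻¹' {(e.symm j).1}) (fun j => f.measurableSet_preimage _)
      (fun j => hvol _ (e.symm j).2) (fun j j' hjj' => by
        refine Disjoint.preimage _ ?_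
        simp only [Set.disjoint_singleton, ne_eq, SetLike.coe_eq_coe, EmbeddingLike.apply_eq_iff_eq]
        exact hjj')
    convert this.precomp e.injective using 2 with c
    simp
  have hcount : ∀ c : s, Measurable (pointCount X (f ⁻¹' {c.1})) := fun c =>
    measurable_pointCount hX.measurable (f.measurableSet_preimage _)
  calc ∫⁻ ω, expE (∑' i, f (X i ω)) ∂P
      = ∫⁻ ω, ∏ c : s, expE (c * (pointCount X (f ⁻¹' {c.1}) ω : ℝ≥0∞)) ∂P := by
        congr 1 with ω
        rw [tsum_simpleFunc_eq_sum_pointCount, ← expE_sum,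
          Finset.sum_coe_sort s fun c => c * (pointCount X (f ⁻¹' {c}) ω : ℝ≥0∞), hs,
          Finset.sum_filter_of_ne]
        intro c _ hc hc0
        simp [hc0] at hc
    _ = ∏ c : s, ∫⁻ ω, expE (c * (pointCount X (f ⁻¹' {c.1}) ω : ℝ≥0∞)) ∂P := by
        refine lintegral_prod_eq_prod_lintegral_of_indepFun _
          (fun (c : s) ω => expE (c * (pointCount X (f ⁻¹' {c.1}) ω : ℝ≥0∞))) ?_ ?_
        · exact hind.comp (fun (c : s) (n : ℕ∞) => expE (c * (n : ℝ≥0∞)))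
            fun c => measurable_of_countable _
        · exact fun c => (measurable_of_countable fun n : ℕ∞ => expE (c * (n : ℝ≥0∞))).comp
            (hcount c)
    _ = ∏ c : s, expE (ENNReal.ofReal lam * ((expE c - 1) * volume (f ⁻¹' {c.1}))) := by
        refine Finset.prod_congr rfl fun c _ => ?_
        rw [lintegral_expE_of_poisson (hcount c)
          (mul_nonneg hlam measureReal_nonneg)
          (hX.poisson _ (f.measurableSet_preimage _) (hvol _ c.2)) (hmem _ c.2).2]
        rw [ENNReal.ofReal_mul hlam, ofReal_measureReal (hvol _ c.2), mul_assoc,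
          mul_comm (volume _)]
    _ = expE (ENNReal.ofReal lam * ∫⁻ x, (expE (f x) - 1)) := by
        rw [← expE_sum, ← Finset.mul_sum,
          Finset.sum_coe_sort s fun c => (expE c - 1) * volume (f ⁻¹' {c})]
        have := SimpleFunc.map_lintegral (μ := (volume : Measure (EuclideanSpace ℝ (Fin d))))
          (fun c => expE c - 1) f
        rw [← SimpleFunc.lintegral_eq_lintegral] at this
        simp only [SimpleFunc.coe_map, Function.comp_apply] at this
        rw [this, hs, Finset.sum_filter_of_ne]
        intro c _ hc hc0
        simp [hc0] at hc

/-- The exponential functional of a Poisson process. -/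
lemma IsPoissonProcess.lintegral_expE_tsum (hX : IsPoissonProcess P lam X) (hlam : 0 ≤ lam)
    {g : EuclideanSpace ℝ (Fin d) → ℝ≥0∞} (hg : Measurable g) :
    ∫⁻ ω, expE (∑' i, g (X i ω)) ∂P =
      expE (ENNReal.ofReal lam * ∫⁻ x, (expE (g x) - 1)) := by
  -- Simple functions increasing to `g`, cut off to growing balls so that each support has finite
  -- volume; both sides then pass to the limit by monotone convergence.
  let f : ℕ → SimpleFunc (EuclideanSpace ℝ (Fin d)) ℝ≥0∞ := fun n =>
    (SimpleFunc.eapprox g n).restrict (Metric.ball 0 n)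
  have hf : ∀ n x, f n x =
      (Metric.ball (0 : EuclideanSpace ℝ (Fin d)) n).indicator (SimpleFunc.eapprox g n) x :=
    fun n x => SimpleFunc.restrict_apply _ measurableSet_ball _
  have hfmono : ∀ x, Monotone fun n => f n x := by
    intro x m n hmn
    simp only [hf]
    refine (Set.indicator_le_indicator_of_subset (Metric.ball_subset_ball (by exact_mod_cast hmn))
      (fun _ => zero_le) x).trans (Set.indicator_le_indicator ?_)
    exact SimpleFunc.monotone_eapprox g hmn x
  have hflim : ∀ x, Filter.Tendsto (fun n => f n x) Filter.atTop (nhds (g x)) := by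
    intro x
    refine (SimpleFunc.tendsto_eapprox hg x).congr' ?_
    obtain ⟨m, hm⟩ := exists_nat_gt ‖x‖
    filter_upwards [Filter.eventually_ge_atTop m] with n hn
    rw [hf, Set.indicator_of_mem]
    simp only [Metric.mem_ball, dist_zero_right]
    exact hm.trans_le (by exact_mod_cast hn)
  have hfsup : ∀ x, ⨆ n, f n x = g x := fun x => iSup_eq_of_tendsto (hfmono x) (hflim x)
  have hsum : ∀ ω, Filter.Tendsto (fun n => ∑' i, f n (X i ω)) Filter.atTop
      (nhds (∑' i, g (X i ω))) := by
    intro ω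
    -- Monotone convergence for the counting measure.
    have : ∑' i, g (X i ω) = ⨆ n, ∑' i, f n (X i ω) := by
      rw [← MeasureTheory.lintegral_count, ← funext fun i => hfsup (X i ω)]
      rw [lintegral_iSup (fun n => measurable_of_countable _)
        (fun m n hmn i => hfmono (X i ω) hmn)]
      simp_rw [MeasureTheory.lintegral_count]
    rw [this]
    exact tendsto_atTop_iSup fun m n hmn => ENNReal.tsum_le_tsum fun i => hfmono _ hmn
  have hl : Filter.Tendsto (fun n => ∫⁻ ω, expE (∑' i, f n (X i ω)) ∂P) Filter.atTop
      (nhds (∫⁻ ω, expE (∑' i, g (X i ω)) ∂P)) := by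
    refine lintegral_tendsto_of_tendsto_of_monotone (fun n => ?_) ?_ ?_
    · exact (measurable_expE.comp (Measurable.tsum fun i =>
        (f n).measurable.comp (hX.measurable i))).aemeasurable
    · exact Filter.Eventually.of_forall fun ω m n hmn => expE_mono
        (ENNReal.tsum_le_tsum fun i => hfmono _ hmn)
    · exact Filter.Eventually.of_forall fun ω => (continuous_expE.tendsto _).comp (hsum ω)
  have hr : Filter.Tendsto (fun n => expE (ENNReal.ofReal lam * ∫⁻ x, (expE (f n x) - 1)))
      Filter.atTop (nhds (expE (ENNReal.ofReal lam * ∫⁻ x, (expE (g x) - 1)))) := by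
    refine (continuous_expE.tendsto _).comp (ENNReal.Tendsto.const_mul ?_
      (Or.inr ENNReal.ofReal_ne_top))
    refine lintegral_tendsto_of_tendsto_of_monotone (fun n => ?_) ?_ ?_
    · exact ((measurable_expE.comp (f n).measurable).sub measurable_const).aemeasurable
    · exact Filter.Eventually.of_forall fun x m n hmn =>
        tsub_le_tsub_right (expE_mono (hfmono x hmn)) 1
    · refine Filter.Eventually.of_forall fun x => ?_
      exact ENNReal.Tendsto.sub ((continuous_expE.tendsto _).comp (hflim x)) tendsto_const_nhds
        (Or.inr ENNReal.one_ne_top)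
  refine tendsto_nhds_unique hl (hr.congr fun n => ?_)
  refine (hX.lintegral_expE_simpleFunc hlam (f n) (fun x => ?_) ?_).symm
  · rw [hf]
    exact ((Set.indicator_le_self _ _ x).trans_lt (SimpleFunc.eapprox_lt_top g n x)).ne
  · refine ne_top_of_le_ne_top (measure_ball_lt_top (μ := (volume : Measure
      (EuclideanSpace ℝ (Fin d)))) (x := 0) (r := n)).ne (measure_mono ?_)
    intro x hx
    by_contra hxn
    exact hx (by rw [hf, Set.indicator_of_notMem hxn])

end Poisson

/-! ### Radial integrals -/

section Radial

/-- Integration of radial functions in polar coordinates. -/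
lemma lintegral_fun_norm {E : Type*} [NormedAddCommGroup E] [NormedSpace ℝ E] [MeasurableSpace E]
    [BorelSpace E] [FiniteDimensional ℝ E] [Nontrivial E] (μ : Measure E) [μ.IsAddHaarMeasure]
    {f : ℝ → ℝ≥0∞} (hf : Measurable f) :
    ∫⁻ x, f ‖x‖ ∂μ = Module.finrank ℝ E * μ (Metric.ball 0 1) *
      ∫⁻ r in Set.Ioi (0 : ℝ), ENNReal.ofReal (r ^ (Module.finrank ℝ E - 1)) * f r := by
  calc ∫⁻ x, f ‖x‖ ∂μ = ∫⁻ x : ({(0)}ᶜ : Set E), f (‖x.1‖) ∂(μ.comap (↑)) := by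
        rw [lintegral_subtype_comap (measurableSet_singleton _).compl fun x ↦ f (‖x‖),
          restrict_compl_singleton]
    _ = ∫⁻ x, f x.2 ∂μ.toSphere.prod (.volumeIoiPow (Module.finrank ℝ E - 1)) := by
        simpa using μ.measurePreserving_homeomorphUnitSphereProd.lintegral_comp_emb
          (Homeomorph.measurableEmbedding _) (f ∘ Subtype.val ∘ Prod.snd)
    _ = μ.toSphere Set.univ * ∫⁻ x : Set.Ioi (0 : ℝ), f x
          ∂.volumeIoiPow (Module.finrank ℝ E - 1) := by
        rw [lintegral_prod _ (by fun_prop)]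
        simp [mul_comm]
    _ = _ := by
        rw [Measure.volumeIoiPow, lintegral_withDensity_eq_lintegral_mul _ (by fun_prop)
          (by fun_prop), μ.toSphere_apply_univ]
        congr 1
        exact lintegral_subtype_comap measurableSet_Ioi
          fun r : ℝ => ENNReal.ofReal (r ^ (Module.finrank ℝ E - 1)) * f r

lemma lintegral_rpow_mul_exp_neg_mul_rpow {p q b : ℝ} (hp : 0 < p) (hq : -1 < q) (hb : 0 < b) :
    ∫⁻ r in Set.Ioi (0 : ℝ), ENNReal.ofReal (r ^ q * Real.exp (-b * r ^ p)) =
      ENNReal.ofReal (b ^ (-(q + 1) / p) * (1 / p) * Real.Gamma ((q + 1) / p)) := by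
  have hI := integral_rpow_mul_exp_neg_mul_rpow hp hq hb
  have hpos : 0 < b ^ (-(q + 1) / p) * (1 / p) * Real.Gamma ((q + 1) / p) := by
    have := Real.Gamma_pos_of_pos (div_pos (by linarith : 0 < q + 1) hp)
    positivity
  rw [← ofReal_integral_eq_lintegral_ofReal, hI]
  -- A non-integrable function would have Bochner integral `0`, whereas the known value is positive;
  -- hence integrability.
  · by_contra h
    rw [integral_undef h] at hI
    exact hpos.ne hI
  · filter_upwards [ae_restrict_mem measurableSet_Ioi] with r hr
    have : (0 : ℝ) < r := hr
    simp only [Pi.zero_apply]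
    positivity

lemma lintegral_rpow_sub_one_mul_exp_neg_mul {m a : ℝ} (hm : 0 < m) (ha : 0 < a) :
    ∫⁻ t in Set.Ioi (0 : ℝ), ENNReal.ofReal (t ^ (m - 1) * Real.exp (-a * t)) =
      ENNReal.ofReal (a ^ (-m) * Real.Gamma m) := by
  have := lintegral_rpow_mul_exp_neg_mul_rpow (p := 1) (q := m - 1) one_pos (by linarith) ha
  simpa using this

/-- A beta integral over the half line. -/
lemma lintegral_rpow_mul_one_add_mul_rpow {q b α m : ℝ} (hα : 0 < α) (hq : -1 < q) (hb : 0 < b)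
    (hm : (q + 1) / α < m) :
    ∫⁻ r in Set.Ioi (0 : ℝ), ENNReal.ofReal (r ^ q * (1 + b * r ^ α) ^ (-m)) =
      ENNReal.ofReal (b ^ (-((q + 1) / α)) / α * Real.Gamma ((q + 1) / α) *
        Real.Gamma (m - (q + 1) / α) / Real.Gamma m) := by
  set s := (q + 1) / α with hs
  have hs0 : 0 < s := div_pos (by linarith) hα
  have hm0 : 0 < m := hs0.trans hm
  have hΓm := Real.Gamma_pos_of_pos hm0
  have hΓs := Real.Gamma_pos_of_pos hs0
  have hΓms := Real.Gamma_pos_of_pos (sub_pos.2 hm)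
  -- The power `(1 + b r^α)^(-m)` is written as a Gamma integral in `t`. After Tonelli the
  -- `r`-integral is again of Gamma type, and so is the remaining `t`-integral.
  have h1 : ∀ r ∈ Set.Ioi (0 : ℝ), ENNReal.ofReal (r ^ q * (1 + b * r ^ α) ^ (-m)) =
      ENNReal.ofReal (Real.Gamma m)⁻¹ * ∫⁻ t in Set.Ioi (0 : ℝ),
        ENNReal.ofReal (t ^ (m - 1) * Real.exp (-t) * (r ^ q * Real.exp (-(t * b) * r ^ α))) := by
    intro r hr
    have hr : 0 < r := hr
    have ha : 0 < 1 + b * r ^ α := by positivity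
    have h2 : ∀ t ∈ Set.Ioi (0 : ℝ),
        ENNReal.ofReal (t ^ (m - 1) * Real.exp (-t) * (r ^ q * Real.exp (-(t * b) * r ^ α))) =
        ENNReal.ofReal (r ^ q) *
          ENNReal.ofReal (t ^ (m - 1) * Real.exp (-(1 + b * r ^ α) * t)) := by
      intro t ht
      rw [← ENNReal.ofReal_mul (by positivity)]
      congr 1
      rw [show -(1 + b * r ^ α) * t = -t + -(t * b) * r ^ α by ring, Real.exp_add]
      ring
    rw [setLIntegral_congr_fun measurableSet_Ioi h2, lintegral_const_mul' _ _ ENNReal.ofReal_ne_top,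
      lintegral_rpow_sub_one_mul_exp_neg_mul hm0 ha, ← ENNReal.ofReal_mul (by positivity),
      ← ENNReal.ofReal_mul (by positivity)]
    congr 1
    field_simp
  have h3 : ∀ t ∈ Set.Ioi (0 : ℝ), ∫⁻ r in Set.Ioi (0 : ℝ),
        ENNReal.ofReal (t ^ (m - 1) * Real.exp (-t) * (r ^ q * Real.exp (-(t * b) * r ^ α))) =
      ENNReal.ofReal (b ^ (-s) * (1 / α) * Real.Gamma s) *
        ENNReal.ofReal (t ^ (m - s - 1) * Real.exp (-1 * t)) := by
    intro t ht
    have ht : 0 < t := ht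
    have h4 : ∀ r : ℝ,
        ENNReal.ofReal (t ^ (m - 1) * Real.exp (-t) * (r ^ q * Real.exp (-(t * b) * r ^ α))) =
        ENNReal.ofReal (t ^ (m - 1) * Real.exp (-t)) *
          ENNReal.ofReal (r ^ q * Real.exp (-(t * b) * r ^ α)) := fun r =>
      ENNReal.ofReal_mul (by positivity)
    simp_rw [h4]
    rw [lintegral_const_mul' _ _ ENNReal.ofReal_ne_top,
      lintegral_rpow_mul_exp_neg_mul_rpow hα hq (by positivity),
      ← ENNReal.ofReal_mul (by positivity), ← ENNReal.ofReal_mul (by positivity)]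
    congr 1
    rw [neg_div, ← hs, Real.mul_rpow ht.le hb.le, show m - s - 1 = (m - 1) + (-s) by ring,
      Real.rpow_add ht, neg_one_mul]
    ring
  rw [setLIntegral_congr_fun measurableSet_Ioi h1, lintegral_const_mul' _ _ ENNReal.ofReal_ne_top,
    lintegral_lintegral_swap, setLIntegral_congr_fun measurableSet_Ioi h3,
    lintegral_const_mul' _ _ ENNReal.ofReal_ne_top,
    lintegral_rpow_sub_one_mul_exp_neg_mul (sub_pos.2 hm) one_pos,
    ← ENNReal.ofReal_mul (by positivity), ← ENNReal.ofReal_mul (by positivity)]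
  · congr 1
    simp
    field_simp
  · exact Measurable.aemeasurable (by fun_prop)

end Radial

/-! ### The space integrals -/

section Space

variable {d : ℕ}

/-- Polar coordinates bring in the Jacobian `r^(d-1)`, which turns this into the half-line beta
integral with `q = d + β - 1`. -/
lemma lintegral_norm_rpow_mul_one_add_mul_rpow (hd : 1 ≤ d) {b α β m : ℝ} (hα : 0 < α)
    (hβ : 0 ≤ β) (hb : 0 < b) (hm : (d + β) / α < m) :
    ∫⁻ x : EuclideanSpace ℝ (Fin d), ENNReal.ofReal (‖x‖ ^ β * (1 + b * ‖x‖ ^ α) ^ (-m)) =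
      ENNReal.ofReal (d * volume.real (Metric.ball (0 : EuclideanSpace ℝ (Fin d)) 1) *
        (b ^ (-((d + β) / α)) / α * Real.Gamma ((d + β) / α) *
          Real.Gamma (m - (d + β) / α) / Real.Gamma m)) := by
  have : Nonempty (Fin d) := ⟨⟨0, hd⟩⟩
  have hd' : (1 : ℝ) ≤ d := by exact_mod_cast hd
  have hdβ : (d + β - 1) + 1 = d + β := by ring
  have hvol : volume (Metric.ball (0 : EuclideanSpace ℝ (Fin d)) 1) ≠ ⊤ := measure_ball_lt_top.ne
  rw [lintegral_fun_norm volume (f := fun r => ENNReal.ofReal (r ^ β * (1 + b * r ^ α) ^ (-m)))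
    (by fun_prop), finrank_euclideanSpace_fin, ENNReal.ofReal_mul (by positivity),
    ENNReal.ofReal_mul (by positivity), ENNReal.ofReal_natCast, ofReal_measureReal hvol, ← hdβ,
    ← lintegral_rpow_mul_one_add_mul_rpow hα (by linarith) hb (by rwa [hdβ])]
  congr 1
  refine setLIntegral_congr_fun measurableSet_Ioi fun r hr => ?_
  have hr : 0 < r := hr
  rw [← ENNReal.ofReal_mul (by positivity), ← mul_assoc]
  congr 2
  rw [← Real.rpow_natCast, ← Real.rpow_add hr, Nat.cast_sub hd]
  congr 1
  push_cast
  ring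

/-- The Laplace transform of the contribution to the interference of a transmitter at `x`. -/
noncomputable def bandLaplace (N : ℕ) (c α : ℝ) (x : EuclideanSpace ℝ (Fin d)) : ℝ≥0∞ :=
  (1 - (N : ℝ≥0∞)⁻¹) + (N : ℝ≥0∞)⁻¹ * (1 + ENNReal.ofReal c * ‖x‖ₑ ^ (-α))⁻¹

lemma bandLaplace_le_one {N : ℕ} (hN : 1 ≤ N) (c α : ℝ) (x : EuclideanSpace ℝ (Fin d)) :
    bandLaplace N c α x ≤ 1 := by
  have hN' : (N : ℝ≥0∞)⁻¹ ≤ 1 := by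
    rw [ENNReal.inv_le_one]; exact_mod_cast hN
  calc bandLaplace N c α x ≤ (1 - (N : ℝ≥0∞)⁻¹) + (N : ℝ≥0∞)⁻¹ * 1 := by
        rw [bandLaplace]
        gcongr
        rw [ENNReal.inv_le_one]
        exact le_self_add
    _ = 1 := by rw [mul_one, tsub_add_cancel_of_le hN']

@[fun_prop]
lemma measurable_bandLaplace (N : ℕ) (c α : ℝ) :
    Measurable (bandLaplace (d := d) N c α) := by
  unfold bandLaplace
  fun_prop

/-- The origin is excluded because for `α > 0` the power `0 ^ (-α)` is `⊤` in `[0, ∞]` but `0` in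
`ℝ`. It is a null set for the space integrals. -/
lemma bandLaplace_eq_ofReal {N : ℕ} (hN : 2 ≤ N) {c : ℝ} (hc : 0 < c) (α : ℝ)
    {x : EuclideanSpace ℝ (Fin d)} (hx : x ≠ 0) :
    bandLaplace N c α x =
      ENNReal.ofReal ((1 - (N : ℝ)⁻¹) + (N : ℝ)⁻¹ * (1 + c * ‖x‖ ^ (-α))⁻¹) := by
  have hx' : 0 < ‖x‖ := norm_pos_iff.2 hx
  have hN' : (2 : ℝ) ≤ N := by exact_mod_cast hN
  have hN1 : (N : ℝ)⁻¹ ≤ 1 := inv_le_one_of_one_le₀ (by linarith)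
  have hNe : (N : ℝ≥0∞)⁻¹ = ENNReal.ofReal (N : ℝ)⁻¹ := by
    rw [ENNReal.ofReal_inv_of_pos (by linarith), ENNReal.ofReal_natCast]
  rw [bandLaplace, hNe, ← ofReal_norm, ENNReal.ofReal_rpow_of_pos hx',
    ← ENNReal.ofReal_mul hc.le, ← ENNReal.ofReal_one, ← ENNReal.ofReal_add zero_le_one
    (by positivity), ← ENNReal.ofReal_inv_of_pos (by positivity),
    ← ENNReal.ofReal_mul (by positivity), ← ENNReal.ofReal_sub _ (by positivity),
    ← ENNReal.ofReal_add (by linarith) (by positivity)]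

lemma real_bandLaplace_pos {N : ℕ} (hN : 2 ≤ N) {c : ℝ} (hc : 0 < c) {t : ℝ} (ht : 0 < t) :
    0 < (1 - (N : ℝ)⁻¹) + (N : ℝ)⁻¹ * (1 + c * t)⁻¹ := by
  have hN' : (2 : ℝ) ≤ N := by exact_mod_cast hN
  have hN1 : (N : ℝ)⁻¹ ≤ 1 := inv_le_one_of_one_le₀ (by linarith)
  have : 0 < (N : ℝ)⁻¹ * (1 + c * t)⁻¹ := by positivity
  linarith

lemma inv_pow_bandLaplace_sub_one {N : ℕ} (hN : 2 ≤ N) {c : ℝ} (hc : 0 < c) (α : ℝ) (j : ℕ)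
    {x : EuclideanSpace ℝ (Fin d)} (hx : x ≠ 0) :
    (bandLaplace N c α x)⁻¹ ^ j - 1 =
      ENNReal.ofReal (((1 - (N : ℝ)⁻¹) + (N : ℝ)⁻¹ * (1 + c * ‖x‖ ^ (-α))⁻¹)⁻¹ ^ j - 1) := by
  have hx' : 0 < ‖x‖ := norm_pos_iff.2 hx
  have hpos := real_bandLaplace_pos hN hc (Real.rpow_pos_of_pos hx' (-α))
  rw [bandLaplace_eq_ofReal hN hc α hx, ← ENNReal.ofReal_inv_of_pos hpos,
    ← ENNReal.ofReal_pow (by positivity), ENNReal.ofReal_sub _ zero_le_one, ENNReal.ofReal_one]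

lemma ae_ne_zero (hd : 1 ≤ d) : ∀ᵐ x : EuclideanSpace ℝ (Fin d), x ≠ 0 := by
  have : Nonempty (Fin d) := ⟨⟨0, hd⟩⟩
  exact Measure.ae_ne volume 0

/-- The first space integral. -/
lemma lintegral_inv_bandLaplace_sub_one (hd : 1 ≤ d) {N : ℕ} (hN : 2 ≤ N) {c α : ℝ} (hc : 0 < c)
    (hα : (d : ℝ) < α) :
    ∫⁻ x : EuclideanSpace ℝ (Fin d), ((bandLaplace N c α x)⁻¹ ^ 1 - 1) =
      ENNReal.ofReal (volume.real (Metric.ball (0 : EuclideanSpace ℝ (Fin d)) 1) * c ^ (d / α) *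
        (1 / Real.sinc (Real.pi * (d / α))) /
          (((N : ℝ) - 1) ^ (1 - d / α) * (N : ℝ) ^ (d / α))) := by
  have hN' : (2 : ℝ) ≤ N := by exact_mod_cast hN
  have hd' : (1 : ℝ) ≤ d := by exact_mod_cast hd
  have hα0 : 0 < α := by linarith
  have hN1 : (0 : ℝ) < N - 1 := by linarith
  set b : ℝ := N / ((N - 1) * c) with hb
  have hb0 : 0 < b := by positivity
  set δ : ℝ := d / α with hδ
  have hδ0 : 0 < δ := by positivity
  have hδ1 : δ < 1 := (div_lt_one hα0).2 hα
  -- With `y = ‖x‖^α` one has `v = (N y + (N-1) c) / (N (y + c))`, hence `v⁻¹ - 1 = c / (N y + (N-1)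
  -- c)`. Factoring out `(N-1) c` explains the choice of `b`.
  have h1 : ∀ᵐ x : EuclideanSpace ℝ (Fin d), (bandLaplace N c α x)⁻¹ ^ 1 - 1 =
      ENNReal.ofReal ((N : ℝ) - 1)⁻¹ *
        ENNReal.ofReal (‖x‖ ^ (0 : ℝ) * (1 + b * ‖x‖ ^ α) ^ (-(1 : ℝ))) := by
    filter_upwards [ae_ne_zero hd] with x hx
    have hx' : 0 < ‖x‖ := norm_pos_iff.2 hx
    rw [inv_pow_bandLaplace_sub_one hN hc α 1 hx, ← ENNReal.ofReal_mul (by positivity)]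
    congr 1
    have hy : 0 < ‖x‖ ^ α := by positivity
    rw [Real.rpow_neg hx'.le, Real.rpow_zero, Real.rpow_neg_one, hb]
    generalize ‖x‖ ^ α = y at hy
    have h2 : 1 - (N : ℝ)⁻¹ + (N : ℝ)⁻¹ * (1 + c * y⁻¹)⁻¹ =
      (N * y + (N - 1) * c) / (N * (y + c)) := by field_simp; ring
    have h3 : 0 < N * y + (N - 1) * c := by positivity
    rw [h2]
    field_simp
    ring
  rw [lintegral_congr_ae h1, lintegral_const_mul' _ _ ENNReal.ofReal_ne_top,
    lintegral_norm_rpow_mul_one_add_mul_rpow hd hα0 le_rfl hb0 (by simpa using hδ1), add_zero,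
    ← ENNReal.ofReal_mul (by positivity), ← hδ]
  congr 1
  have hsin : 0 < Real.sin (Real.pi * δ) :=
    Real.sin_pos_of_pos_of_lt_pi (by positivity) (by nlinarith [Real.pi_pos])
  have hG := Real.Gamma_mul_Gamma_one_sub δ
  have hbδ : b ^ (-δ) = c ^ δ * (N - 1) ^ δ / N ^ δ := by
    rw [Real.rpow_neg hb0.le, hb, Real.div_rpow (by positivity) (by positivity),
      Real.mul_rpow hN1.le hc.le]
    field_simp
  rw [Real.Gamma_one, mul_assoc _ (Real.Gamma δ), hG, hbδ, Real.sinc_of_ne_zero (by positivity),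
    Real.rpow_sub hN1, Real.rpow_one, show (d : ℝ) = δ * α by rw [hδ]; field_simp]
  field_simp

/-- The second space integral. -/
lemma lintegral_inv_sq_bandLaplace_sub_one (hd : 1 ≤ d) {N : ℕ} (hN : 2 ≤ N) {c α : ℝ}
    (hc : 0 < c) (hα : (d : ℝ) < α) :
    ∫⁻ x : EuclideanSpace ℝ (Fin d), ((bandLaplace N c α x)⁻¹ ^ 2 - 1) =
      ENNReal.ofReal ((2 * (N : ℝ) - 1 - d / α) *
        (volume.real (Metric.ball (0 : EuclideanSpace ℝ (Fin d)) 1) * c ^ (d / α) *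
        (1 / Real.sinc (Real.pi * (d / α)))) /
          ((N : ℝ) ^ (d / α) * ((N : ℝ) - 1) ^ (2 - d / α))) := by
  have hN' : (2 : ℝ) ≤ N := by exact_mod_cast hN
  have hd' : (1 : ℝ) ≤ d := by exact_mod_cast hd
  have hα0 : 0 < α := by linarith
  have hN1 : (0 : ℝ) < N - 1 := by linarith
  set b : ℝ := N / ((N - 1) * c) with hb
  have hb0 : 0 < b := by positivity
  set δ : ℝ := d / α with hδ
  have hδ0 : 0 < δ := by positivity
  have hδ1 : δ < 1 := (div_lt_one hα0).2 hα
  have hδ2 : (d + α) / α = δ + 1 := by rw [hδ]; field_simp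
  -- With `w = (1 + b y)⁻¹`, factor `v⁻² - 1 = (v⁻¹ - 1)(v⁻¹ + 1) = w/(N-1) * (2 + w/(N-1))` and
  -- write `2 = 2 (1 + b y) w`. This gives two beta integrands with `m = 2`.
  have h1 : ∀ᵐ x : EuclideanSpace ℝ (Fin d), (bandLaplace N c α x)⁻¹ ^ 2 - 1 =
      ENNReal.ofReal (2 * b / ((N : ℝ) - 1)) *
        ENNReal.ofReal (‖x‖ ^ α * (1 + b * ‖x‖ ^ α) ^ (-(2 : ℝ))) +
      ENNReal.ofReal ((2 * N - 1) / ((N : ℝ) - 1) ^ 2) *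
        ENNReal.ofReal (‖x‖ ^ (0 : ℝ) * (1 + b * ‖x‖ ^ α) ^ (-(2 : ℝ))) := by
    filter_upwards [ae_ne_zero hd] with x hx
    have hx' : 0 < ‖x‖ := norm_pos_iff.2 hx
    have h2N : (0 : ℝ) < 2 * N - 1 := by linarith
    rw [inv_pow_bandLaplace_sub_one hN hc α 2 hx, ← ENNReal.ofReal_mul (by positivity),
      ← ENNReal.ofReal_mul (by positivity), ← ENNReal.ofReal_add (by positivity) (by positivity)]
    congr 1
    have hy : 0 < ‖x‖ ^ α := by positivity
    rw [Real.rpow_neg hx'.le, Real.rpow_zero, Real.rpow_neg (by positivity), Real.rpow_two, hb]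
    generalize ‖x‖ ^ α = y at hy
    have h2 : 1 - (N : ℝ)⁻¹ + (N : ℝ)⁻¹ * (1 + c * y⁻¹)⁻¹ =
      (N * y + (N - 1) * c) / (N * (y + c)) := by field_simp; ring
    have h3 : 0 < N * y + (N - 1) * c := by positivity
    rw [h2]
    field_simp
    ring
  have hsin : 0 < Real.sin (Real.pi * δ) :=
    Real.sin_pos_of_pos_of_lt_pi (by positivity) (by nlinarith [Real.pi_pos])
  have hG := Real.Gamma_mul_Gamma_one_sub δ
  have hG1 : 0 < Real.Gamma δ := Real.Gamma_pos_of_pos hδ0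
  have hG2 : 0 < Real.Gamma (1 - δ) := Real.Gamma_pos_of_pos (by linarith)
  have hG3 : Real.Gamma (2 - δ) = (1 - δ) * Real.Gamma (1 - δ) := by
    rw [← Real.Gamma_add_one (by linarith)]; congr 1; ring
  have h2N : (0 : ℝ) < 2 * N - 1 := by linarith
  have h1δ : (0 : ℝ) < 1 - δ := by linarith
  rw [lintegral_congr_ae h1, lintegral_add_left (by fun_prop),
    lintegral_const_mul' _ _ ENNReal.ofReal_ne_top,
    lintegral_const_mul' _ _ ENNReal.ofReal_ne_top,
    lintegral_norm_rpow_mul_one_add_mul_rpow hd hα0 hα0.le hb0 (by rw [hδ2]; linarith),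
    lintegral_norm_rpow_mul_one_add_mul_rpow hd hα0 le_rfl hb0 (by rw [add_zero]; linarith),
    add_zero, hδ2, ← hδ, show 2 - (δ + 1) = 1 - δ by ring, Real.Gamma_two, hG3,
    Real.Gamma_add_one hδ0.ne', ← ENNReal.ofReal_mul (by positivity),
    ← ENNReal.ofReal_mul (by positivity), ← ENNReal.ofReal_add (by positivity) (by positivity)]
  congr 1
  have hbδ : b ^ (-δ) = c ^ δ * (N - 1) ^ δ / N ^ δ := by
    rw [Real.rpow_neg hb0.le, hb, Real.div_rpow (by positivity) (by positivity),
      Real.mul_rpow hN1.le hc.le]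
    field_simp
  have hbδ1 : b ^ (-(δ + 1)) = b ^ (-δ) / b := by
    rw [neg_add, Real.rpow_add hb0, Real.rpow_neg_one]; rfl
  rw [Real.sinc_of_ne_zero (by positivity), Real.rpow_sub hN1, Real.rpow_two, hbδ1,
    show (d : ℝ) = δ * α by rw [hδ]; field_simp]
  -- Here `v` stands for the volume of the unit ball. Both terms are multiples of `Γ(δ)Γ(1-δ)`, and
  -- the bracket equals `(2N - 1 - δ)/(N-1)²`, the source of the factor `2N - 1 - δ`.
  have e1 : ∀ v : ℝ, 2 * b / (N - 1) * (δ * α * v * (b ^ (-δ) / b / α * (δ * Real.Gamma δ) *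
      Real.Gamma (1 - δ) / 1)) + (2 * N - 1) / (N - 1) ^ 2 * (δ * α * v *
      (b ^ (-δ) / α * Real.Gamma δ * ((1 - δ) * Real.Gamma (1 - δ)) / 1)) =
      (2 * δ / (N - 1) + (2 * N - 1) * (1 - δ) / (N - 1) ^ 2) * δ * v * b ^ (-δ) *
        (Real.Gamma δ * Real.Gamma (1 - δ)) := by
    intro v
    field_simp
  rw [e1, hG, hbδ]
  field_simp
  ring

end Space

/-! ### Waiting times in a set of time slots -/

section Slots

variable {A : Set ℕ}

lemma inter_Iio_succ_of_mem {n : ℕ} (h : n ∈ A) :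
    A ∩ Set.Iio (n + 1) = insert n (A ∩ Set.Iio n) := by
  ext k
  simp only [Set.mem_inter_iff, Set.mem_Iio, Set.mem_insert_iff]
  constructor
  · rintro ⟨h1, h2⟩
    rcases Nat.lt_succ_iff_lt_or_eq.1 h2 with h3 | h3
    · exact Or.inr ⟨h1, h3⟩
    · exact Or.inl h3
  · rintro (rfl | ⟨h1, h2⟩)
    · exact ⟨h, Nat.lt_succ_self _⟩
    · exact ⟨h1, h2.trans (Nat.lt_succ_self _)⟩

lemma inter_Iio_succ_of_notMem {n : ℕ} (h : n ∉ A) :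
    A ∩ Set.Iio (n + 1) = A ∩ Set.Iio n := by
  ext k
  simp only [Set.mem_inter_iff, Set.mem_Iio]
  constructor
  · rintro ⟨h1, h2⟩
    rcases Nat.lt_succ_iff_lt_or_eq.1 h2 with h3 | rfl
    · exact ⟨h1, h3⟩
    · exact absurd h1 h
  · rintro ⟨h1, h2⟩
    exact ⟨h1, h2.trans (Nat.lt_succ_self _)⟩

lemma finite_inter_Iio (A : Set ℕ) (n : ℕ) : (A ∩ Set.Iio n).Finite :=
  (Set.finite_Iio n).inter_of_right A

lemma ncard_inter_Iio_succ_of_mem {n : ℕ} (h : n ∈ A) :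
    (A ∩ Set.Iio (n + 1)).ncard = (A ∩ Set.Iio n).ncard + 1 := by
  rw [inter_Iio_succ_of_mem h, Set.ncard_insert_of_notMem (by simp) (finite_inter_Iio A n)]

lemma ncard_inter_Iio_mono (A : Set ℕ) : Monotone fun n => (A ∩ Set.Iio n).ncard :=
  fun _ n hmn => Set.ncard_le_ncard
    (Set.inter_subset_inter_right _ (Set.Iio_subset_Iio hmn)) (finite_inter_Iio A n)

lemma ncard_inter_Iio_add_eq_iff (A : Set ℕ) (s n : ℕ) :
    (A ∩ Set.Iio (s + n)).ncard = (A ∩ Set.Iio s).ncard ↔ ∀ k, s ≤ k → k < s + n → k ∉ A := by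
  constructor
  · intro h k hk1 hk2 hkA
    have h1 : (A ∩ Set.Iio s).ncard ≤ (A ∩ Set.Iio k).ncard := ncard_inter_Iio_mono A hk1
    have h2 : (A ∩ Set.Iio (k + 1)).ncard ≤ (A ∩ Set.Iio (s + n)).ncard :=
      ncard_inter_Iio_mono A hk2
    rw [ncard_inter_Iio_succ_of_mem hkA] at h2
    omega
  · intro h
    congr 1
    ext k
    simp only [Set.mem_inter_iff, Set.mem_Iio]
    constructor
    · rintro ⟨h1, h2⟩
      refine ⟨h1, ?_⟩
      by_contra h3
      exact h k (not_lt.1 h3) h2 h1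
    · rintro ⟨h1, h2⟩
      exact ⟨h1, by omega⟩

/-- The count of successes is monotone in `n`, so the infimum is governed by a threshold. Statements
about `slotsUntil` thereby become statements about counts. -/
lemma slotsUntil_le_iff {j n : ℕ} : slotsUntil A j ≤ n ↔ j ≤ (A ∩ Set.Iio n).ncard := by
  constructor
  · intro h
    have h' : slotsUntil A j < (n + 1 : ℕ) := h.trans_lt (by exact_mod_cast Nat.lt_succ_self n)
    simp only [slotsUntil, iInf_lt_iff] at h'
    obtain ⟨m, hm, hmn⟩ := h'
    exact hm.trans (ncard_inter_Iio_mono A (Nat.lt_succ_iff.1 (by exact_mod_cast hmn)))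
  · intro h
    exact iInf₂_le n h

@[simp] lemma slotsUntil_zero (A : Set ℕ) : slotsUntil A 0 = 0 := by
  have : slotsUntil A 0 ≤ (0 : ℕ) := slotsUntil_le_iff.2 (Nat.zero_le _)
  simpa using this

lemma slotsUntil_mono (A : Set ℕ) : Monotone (slotsUntil A) := by
  intro i j hij
  exact le_iInf₂ fun n hn => slotsUntil_le_iff.2 (hij.trans hn)

lemma slotsUntil_succ_ne_zero (A : Set ℕ) (j : ℕ) : slotsUntil A (j + 1) ≠ 0 := by
  intro h
  have : slotsUntil A (j + 1) ≤ (0 : ℕ) := by simp [h]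
  rw [slotsUntil_le_iff] at this
  simp at this

/-- Slots are numbered from `0`, so a success in slot `n` is completed after `n + 1` slots; the
other `j` successes precede it. -/
lemma slotsUntil_succ_eq_iff {j n : ℕ} :
    slotsUntil A (j + 1) = (n + 1 : ℕ) ↔ (A ∩ Set.Iio n).ncard = j ∧ n ∈ A := by
  have h : slotsUntil A (j + 1) = (n + 1 : ℕ) ↔
      slotsUntil A (j + 1) ≤ (n + 1 : ℕ) ∧ ¬ slotsUntil A (j + 1) ≤ n := by
    constructor
    · intro h
      rw [h]
      exact ⟨le_rfl, not_le.2 (by exact_mod_cast n.lt_succ_self)⟩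
    · rintro ⟨h1, h2⟩
      refine le_antisymm h1 ?_
      rw [not_le] at h2
      have := Order.add_one_le_of_lt h2
      exact_mod_cast this
  rw [h, slotsUntil_le_iff, slotsUntil_le_iff]
  by_cases hn : n ∈ A
  · rw [ncard_inter_Iio_succ_of_mem hn]
    simp only [hn, and_true]
    omega
  · rw [inter_Iio_succ_of_notMem hn]
    exact iff_of_false (fun h => h.2 h.1) fun h => hn h.2

lemma slotsUntil_eq_sum (A : Set ℕ) (M : ℕ) :
    slotsUntil A M = ∑ i ∈ Finset.range M, (slotsUntil A (i + 1) - slotsUntil A i) := by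
  induction M with
  | zero => simp
  | succ M ih =>
    rw [Finset.sum_range_succ, ← ih, add_tsub_cancel_of_le (slotsUntil_mono A M.le_succ)]

lemma ncard_inter_Iio_of_slotsUntil_eq {M s : ℕ} (h : slotsUntil A M = s) :
    (A ∩ Set.Iio s).ncard = M := by
  rcases M with _ | M
  · have : s = 0 := by simpa using h.symm
    subst this
    simp
  · rcases s with _ | s
    · exact absurd h (slotsUntil_succ_ne_zero A M)
    · obtain ⟨h1, h2⟩ := slotsUntil_succ_eq_iff.1 h
      rw [ncard_inter_Iio_succ_of_mem h2, h1]

/-- The slot of the `M`-th success when the successive waiting times are `n i + 1`. -/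
def successTime (n : ℕ → ℕ) (M : ℕ) : ℕ := ∑ i ∈ Finset.range M, (n i + 1)

lemma successTime_succ (n : ℕ → ℕ) (M : ℕ) :
    successTime n (M + 1) = successTime n M + n M + 1 := by
  rw [successTime, Finset.sum_range_succ, ← successTime, add_assoc]

lemma strictMono_successTime (n : ℕ → ℕ) : StrictMono (successTime n) :=
  strictMono_nat_of_lt_succ fun M => by rw [successTime_succ]; omega

/-- The set of the slots of the successes when the successive waiting times are `n i + 1`. -/
def successPattern (n : ℕ → ℕ) : Set ℕ := {k | ∃ i, k + 1 = successTime n (i + 1)}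

lemma mem_successPattern_iff {n : ℕ → ℕ} {M k : ℕ} (h1 : successTime n M ≤ k)
    (h2 : k < successTime n (M + 1)) : k ∈ successPattern n ↔ k = successTime n M + n M := by
  constructor
  · rintro ⟨i, hi⟩
    have h3 : M < i + 1 := (strictMono_successTime n).lt_iff_lt.1 (by omega)
    have h4 : i + 1 < M + 2 := (strictMono_successTime n).lt_iff_lt.1 (by
      rw [← hi]
      exact (Nat.succ_le_iff.2 h2).trans_lt (strictMono_successTime n (Nat.lt_succ_self _)))
    have : i = M := by omega
    subst this
    rw [successTime_succ] at hi
    omega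
  · rintro rfl
    exact ⟨M, by rw [successTime_succ]⟩

/-- Prescribing the first `M` waiting times amounts to prescribing success or failure in each of the
first `successTime n M` slots. This is a finite cylinder event, whose probability is a product. -/
lemma waiting_times_eq_iff (A : Set ℕ) (n : ℕ → ℕ) (M : ℕ) :
    (∀ i < M, slotsUntil A (i + 1) - slotsUntil A i = (n i + 1 : ℕ)) ↔
      ∀ k < successTime n M, (k ∈ A ↔ k ∈ successPattern n) := by
  induction M with
  | zero => simp [successTime]
  | succ M ih =>
    rw [Nat.forall_lt_succ_right, ih, successTime_succ, ← successTime_succ]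
    have hsplit : (∀ k < successTime n (M + 1), (k ∈ A ↔ k ∈ successPattern n)) ↔
        (∀ k < successTime n M, (k ∈ A ↔ k ∈ successPattern n)) ∧
        ∀ k, successTime n M ≤ k → k < successTime n (M + 1) →
          (k ∈ A ↔ k ∈ successPattern n) := by
      constructor
      · intro h
        exact ⟨fun k hk => h k (hk.trans (strictMono_successTime n (Nat.lt_succ_self M))),
          fun k _ hk => h k hk⟩
      · rintro ⟨h1, h2⟩ k hk
        rcases lt_or_ge k (successTime n M) with h | h
        · exact h1 k h
        · exact h2 k h hk
    rw [hsplit]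
    refine and_congr_right fun hM => ?_
    have hM' := ih.2 hM
    have hsM : slotsUntil A M = (successTime n M : ℕ) := by
      rw [slotsUntil_eq_sum, Finset.sum_congr rfl fun i hi => hM' i (Finset.mem_range.1 hi),
        successTime]
      push_cast
      rfl
    have hcount := ncard_inter_Iio_of_slotsUntil_eq hsM
    -- Subtraction in `ℕ∞` can be undone here because the subtrahend is finite and is at most the
    -- minuend.
    have h1 : slotsUntil A (M + 1) - slotsUntil A M = (n M + 1 : ℕ) ↔
        slotsUntil A (M + 1) = (successTime n M + n M + 1 : ℕ) := by
      have hle := slotsUntil_mono A M.le_succ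
      rw [hsM] at hle ⊢
      generalize slotsUntil A (M + 1) = x at hle
      induction x using ENat.recTopCoe with
      | top =>
        rw [ENat.top_sub_natCast]
        exact iff_of_false (ENat.top_ne_natCast _) (ENat.top_ne_natCast _)
      | coe x =>
        have hle' : successTime n M ≤ x := by exact_mod_cast hle
        rw [← ENat.natCast_sub, Nat.cast_inj, Nat.cast_inj]
        omega
    rw [h1, slotsUntil_succ_eq_iff]
    have h2 : (A ∩ Set.Iio (successTime n M + n M)).ncard = M ↔
        ∀ k, successTime n M ≤ k → k < successTime n M + n M → k ∉ A := by
      rw [← ncard_inter_Iio_add_eq_iff, hcount]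
    rw [h2]
    constructor
    · rintro ⟨h2, h3⟩ k hk1 hk2
      rw [mem_successPattern_iff hk1 hk2]
      constructor
      · intro hkA
        by_contra hne
        rw [successTime_succ] at hk2
        exact h2 k hk1 (by omega) hkA
      · rintro rfl
        exact h3
    · intro h
      refine ⟨fun k hk1 hk2 hkA => ?_, ?_⟩
      · have hk3 : k < successTime n (M + 1) := by rw [successTime_succ]; omega
        rw [h k hk1 hk3, mem_successPattern_iff hk1 hk3] at hkA
        omega
      · have hk3 : successTime n M + n M < successTime n (M + 1) := by rw [successTime_succ]; omega
        rw [h _ (by omega) hk3, mem_successPattern_iff (by omega) hk3]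

end Slots

/-! ### Waiting times for independent trials -/

section Bernoulli

variable {Ω : Type*} [MeasurableSpace Ω] {P : Measure Ω}
  {A : Ω → Set ℕ}

lemma measurable_ncard_inter_Iio (hA : ∀ k, MeasurableSet {ω | k ∈ A ω}) (n : ℕ) :
    Measurable fun ω => (A ω ∩ Set.Iio n).ncard := by
  classical
  induction n with
  | zero => simp
  | succ n ih =>
    have : (fun ω => (A ω ∩ Set.Iio (n + 1)).ncard) = fun ω =>
        (A ω ∩ Set.Iio n).ncard + if ω ∈ {ω | n ∈ A ω} then 1 else 0 := by
      ext ω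
      by_cases h : n ∈ A ω
      · rw [ncard_inter_Iio_succ_of_mem h]; simp [h]
      · rw [inter_Iio_succ_of_notMem h]; simp [h]
    rw [this]
    exact ih.add (Measurable.ite (hA n) measurable_const measurable_const)

lemma measurable_slotsUntil (hA : ∀ k, MeasurableSet {ω | k ∈ A ω}) (j : ℕ) :
    Measurable fun ω => slotsUntil (A ω) j := by
  have hle : ∀ n : ℕ, MeasurableSet {ω | slotsUntil (A ω) j ≤ n} := by
    intro n
    simp_rw [slotsUntil_le_iff]
    exact measurable_ncard_inter_Iio hA n (Set.to_countable {m | j ≤ m}).measurableSet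
  have hcoe : ∀ n : ℕ, MeasurableSet {ω | slotsUntil (A ω) j = n} := by
    intro n
    rcases n with _ | n
    · simpa using hle 0
    · have : {ω | slotsUntil (A ω) j = (n + 1 : ℕ)} =
          {ω | slotsUntil (A ω) j ≤ (n + 1 : ℕ)} \ {ω | slotsUntil (A ω) j ≤ n} := by
        ext ω
        simp only [Set.mem_ofPred_eq, Set.mem_sdiff, not_le]
        constructor
        · intro h
          rw [h]
          exact ⟨le_rfl, by exact_mod_cast n.lt_succ_self⟩
        · rintro ⟨h1, h2⟩
          exact le_antisymm h1 (by exact_mod_cast Order.add_one_le_of_lt h2)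
      rw [this]
      exact (hle _).diff (hle _)
  refine measurable_to_countable' fun x => ?_
  induction x using ENat.recTopCoe with
  | coe n => exact hcoe n
  | top =>
    have : (fun ω => slotsUntil (A ω) j) ⁻¹' {⊤} = (⋃ n : ℕ, {ω | slotsUntil (A ω) j = n})ᶜ := by
      ext ω
      simp only [Set.mem_preimage, Set.mem_singleton_iff, Set.mem_compl_iff, Set.mem_iUnion,
        Set.mem_ofPred_eq, not_exists]
      constructor
      · intro h n hn
        rw [h] at hn
        exact ENat.top_ne_natCast n hn
      · intro h
        by_contra hne
        exact h _ (ENat.natCast_toNat hne).symm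
    rw [this]
    exact (MeasurableSet.iUnion hcoe).compl

variable [IsProbabilityMeasure P] {p : ℝ≥0∞}

lemma measurableSet_pattern (hA : ∀ k, MeasurableSet {ω | k ∈ A ω}) (n : ℕ) (D : Set ℕ) :
    MeasurableSet {ω | ∀ k < n, (k ∈ A ω ↔ k ∈ D)} := by
  have : {ω | ∀ k < n, (k ∈ A ω ↔ k ∈ D)} = ⋂ k ∈ Set.Iio n, {ω | k ∈ A ω ↔ k ∈ D} := by
    ext ω; simp
  rw [this]
  refine MeasurableSet.biInter (Set.to_countable _) fun k _ => ?_
  by_cases hk : k ∈ D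
  · simpa [hk] using hA k
  · simp only [hk, iff_false]
    exact (hA k).compl

open Classical in
lemma measure_pattern (hA : ∀ k, MeasurableSet {ω | k ∈ A ω})
    (hind : iIndepSet (fun k => {ω | k ∈ A ω}) P) (hp : ∀ k, P {ω | k ∈ A ω} = p)
    (n : ℕ) (D : Set ℕ) :
    P {ω | ∀ k < n, (k ∈ A ω ↔ k ∈ D)} =
      ∏ k ∈ Finset.range n, if k ∈ D then p else 1 - p := by
  have : {ω | ∀ k < n, (k ∈ A ω ↔ k ∈ D)} =
      ⋂ k ∈ Finset.range n, if k ∈ D then {ω | k ∈ A ω} else {ω | k ∈ A ω}ᶜ := by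
    ext ω
    simp only [Set.mem_ofPred_eq, Finset.mem_range, Set.mem_iInter]
    refine forall₂_congr fun k _ => ?_
    by_cases hk : k ∈ D <;> simp [hk]
  rw [this, iIndep.meas_biInter hind]
  · refine Finset.prod_congr rfl fun k _ => ?_
    by_cases hk : k ∈ D
    · simp [hk, hp]
    · simp only [hk, if_false]
      rw [prob_compl_eq_one_sub (hA k), hp]
  · intro k _
    have := MeasurableSpace.measurableSet_generateFrom (Set.mem_singleton {ω | k ∈ A ω})
    by_cases hk : k ∈ D
    · simpa [hk] using this
    · simpa [hk] using this.compl

/-- The successive waiting times are independent and geometrically distributed. -/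
lemma measure_waiting_times (hA : ∀ k, MeasurableSet {ω | k ∈ A ω})
    (hind : iIndepSet (fun k => {ω | k ∈ A ω}) P) (hp : ∀ k, P {ω | k ∈ A ω} = p)
    (M : ℕ) (n : ℕ → ℕ) :
    P {ω | ∀ i < M, slotsUntil (A ω) (i + 1) - slotsUntil (A ω) i = (n i + 1 : ℕ)} =
      ∏ i ∈ Finset.range M, (1 - p) ^ n i * p := by
  classical
  simp_rw [waiting_times_eq_iff]
  rw [measure_pattern hA hind hp]
  induction M with
  | zero => simp [successTime]
  | succ M ih =>
    -- The slots added by the last waiting time are `n M` failures followed by one success.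
    rw [Finset.prod_range_succ, ← ih, successTime_succ, Finset.prod_range_succ,
      Finset.prod_range_add, mul_assoc]
    congr 2
    · rw [Finset.prod_congr rfl fun i hi => if_neg ?_, Finset.prod_const, Finset.card_range]
      have hi' := Finset.mem_range.1 hi
      rw [mem_successPattern_iff (M := M) (by omega) (by rw [successTime_succ]; omega)]
      omega
    · rw [if_pos]
      rw [mem_successPattern_iff (M := M) (by omega) (by rw [successTime_succ]; omega)]

/-- The waiting time for the `(k + 1)`-st success has a negative binomial distribution. -/
lemma measure_slotsUntil_succ_eq (hA : ∀ k, MeasurableSet {ω | k ∈ A ω})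
    (hind : iIndepSet (fun k => {ω | k ∈ A ω}) P) (hp : ∀ k, P {ω | k ∈ A ω} = p)
    (k n : ℕ) :
    P {ω | slotsUntil (A ω) (k + 1) = (n + 1 : ℕ)} =
      n.choose k * (p ^ (k + 1) * (1 - p) ^ (n - k)) := by
  classical
  -- Slot `n` is a success and `D` is the set of the `k` earlier ones: `n.choose k` disjoint
  -- cylinder events of equal probability.
  have hU : {ω | slotsUntil (A ω) (k + 1) = (n + 1 : ℕ)} =
      ⋃ D ∈ Finset.powersetCard k (Finset.range n),
        {ω | ∀ j < n + 1, (j ∈ A ω ↔ j ∈ ((insert n D : Finset ℕ) : Set ℕ))} := by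
    ext ω
    simp only [slotsUntil_succ_eq_iff, Set.mem_ofPred_eq, Set.mem_iUnion, exists_prop,
      Finset.mem_powersetCard, Finset.mem_coe, Finset.mem_insert]
    constructor
    · rintro ⟨h1, h2⟩
      refine ⟨(finite_inter_Iio (A ω) n).toFinset, ⟨fun j hj => ?_, ?_⟩, fun j hj => ?_⟩
      · simpa using (by simpa using hj : j ∈ A ω ∧ j < n).2
      · rw [← Set.ncard_eq_toFinset_card _ (finite_inter_Iio (A ω) n), h1]
      · simp only [Set.Finite.mem_toFinset, Set.mem_inter_iff, Set.mem_Iio]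
        rcases Nat.lt_succ_iff_lt_or_eq.1 hj with h3 | rfl
        · simp [h3, h3.ne]
        · simp [h2]
    · rintro ⟨D, ⟨h1, h2⟩, h3⟩
      refine ⟨?_, (h3 n (Nat.lt_succ_self n)).2 (Or.inl rfl)⟩
      rw [← h2, ← Set.ncard_coe_finset]
      congr 1
      ext j
      simp only [Set.mem_inter_iff, Set.mem_Iio, Finset.mem_coe]
      constructor
      · rintro ⟨h4, h5⟩
        exact ((h3 j (h5.trans (Nat.lt_succ_self n))).1 h4).resolve_left h5.ne
      · intro h4
        have h5 : j < n := Finset.mem_range.1 (h1 h4)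
        exact ⟨(h3 j (h5.trans (Nat.lt_succ_self n))).2 (Or.inr h4), h5⟩
  rw [hU, measure_biUnion_finset]
  · have hterm : ∀ D ∈ Finset.powersetCard k (Finset.range n),
        P {ω | ∀ j < n + 1, (j ∈ A ω ↔ j ∈ ((insert n D : Finset ℕ) : Set ℕ))} =
          p ^ (k + 1) * (1 - p) ^ (n - k) := by
      intro D hD
      obtain ⟨h1, h2⟩ := Finset.mem_powersetCard.1 hD
      have hn : n ∉ D := fun h => by simpa using h1 h
      have hsub : insert n D ⊆ Finset.range (n + 1) := by
        rw [Finset.range_add_one]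
        exact Finset.insert_subset_insert _ h1
      have hcard : (insert n D).card = k + 1 := by rw [Finset.card_insert_of_notMem hn, h2]
      rw [measure_pattern hA hind hp, ← Finset.prod_sdiff hsub,
        Finset.prod_eq_pow_card (s := Finset.range (n + 1) \ insert n D) (b := 1 - p),
        Finset.prod_eq_pow_card (s := insert n D) (b := p), Finset.card_sdiff_of_subset hsub,
        hcard, Finset.card_range, Nat.add_sub_add_right, mul_comm]
      · exact fun j hj => if_pos (Finset.mem_coe.2 hj)
      · exact fun j hj => if_neg fun h => (Finset.mem_sdiff.1 hj).2 (Finset.mem_coe.1 h)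
    rw [Finset.sum_congr rfl hterm, Finset.sum_const, Finset.card_powersetCard, Finset.card_range,
      nsmul_eq_mul]
  · intro D hD D' hD' hne
    rw [Function.onFun, Set.disjoint_left]
    intro ω h1 h2
    simp only [Set.mem_ofPred_eq] at h1 h2
    refine hne ?_
    have hsub := (Finset.mem_powersetCard.1 hD).1
    have hsub' := (Finset.mem_powersetCard.1 hD').1
    ext j
    by_cases hj : j < n
    · have := (h1 j (by omega)).symm.trans (h2 j (by omega))
      simpa [hj.ne] using this
    · exact iff_of_false (fun h => hj (Finset.mem_range.1 (hsub h)))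
        fun h => hj (Finset.mem_range.1 (hsub' h))
  · exact fun D _ => measurableSet_pattern hA _ _

/-- The negative binomial series. The index `j` is kept apart from `k`: `j = k` gives the total
mass, `j = k + 1` the mean and `j = k + 2` the second factorial moment. -/
lemma tsum_choose_mul_pow_sub {p : ℝ} (hp0 : 0 < p) (hp1 : p ≤ 1) (k j : ℕ) :
    ∑' m : ℕ, ENNReal.ofReal ((m + j).choose j * (p ^ (k + 1) * (1 - p) ^ m)) =
      ENNReal.ofReal (p ^ (k + 1) / p ^ (j + 1)) := by
  have hq : ‖1 - p‖ < 1 := by rw [Real.norm_eq_abs, abs_of_nonneg (by linarith)]; linarith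
  have h := (hasSum_choose_mul_geometric_of_norm_lt_one j hq).mul_left (p ^ (k + 1))
  rw [sub_sub_cancel, mul_one_div] at h
  have h' : HasSum (fun m : ℕ => ((m + j).choose j * (p ^ (k + 1) * (1 - p) ^ m) : ℝ))
      (p ^ (k + 1) / p ^ (j + 1)) := by
    refine h.congr_fun ?_
    exact fun m => by ring
  rw [← h'.tsum_eq, ENNReal.ofReal_tsum_of_nonneg (fun m => ?_) h'.summable]
  have : 0 ≤ 1 - p := by linarith
  positivity

/-- The `(k + 1)`-st success needs at least `k + 1` slots, so the sum may be reindexed by the number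
`m` of failures. -/
lemma tsum_mul_measure_slotsUntil (hA : ∀ k, MeasurableSet {ω | k ∈ A ω})
    (hind : iIndepSet (fun k => {ω | k ∈ A ω}) P) (hp : ∀ k, P {ω | k ∈ A ω} = p)
    (k : ℕ) (F : ℕ → ℝ≥0∞) :
    ∑' n : ℕ, F n * P {ω | slotsUntil (A ω) (k + 1) = n} =
      ∑' m : ℕ, F (m + k + 1) *
        ENNReal.ofReal ((m + k).choose k * (p.toReal ^ (k + 1) * (1 - p.toReal) ^ m)) := by
  have hp1 : p ≤ 1 := hp 0 ▸ prob_le_one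
  have hpr1 : p.toReal ≤ 1 := ENNReal.toReal_le_of_le_ofReal zero_le_one (by simpa using hp1)
  have hpr : p = ENNReal.ofReal p.toReal :=
    (ENNReal.ofReal_toReal (ne_top_of_le_ne_top ENNReal.one_ne_top hp1)).symm
  have h0 : {ω | slotsUntil (A ω) (k + 1) = (0 : ℕ)} = ∅ := by
    ext ω
    simpa using slotsUntil_succ_ne_zero (A ω) k
  rw [tsum_eq_zero_add' ENNReal.summable, h0, measure_empty, mul_zero, zero_add]
  simp_rw [measure_slotsUntil_succ_eq hA hind hp]
  rw [← ENNReal.summable.sum_add_tsum_nat_add' (k := k), Finset.sum_eq_zero, zero_add]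
  · congr 1 with m
    rw [Nat.add_sub_cancel]
    congr 1
    rw [ENNReal.ofReal_mul (by positivity), ENNReal.ofReal_natCast,
      ENNReal.ofReal_mul (by positivity), ENNReal.ofReal_pow ENNReal.toReal_nonneg,
      ENNReal.ofReal_pow (by linarith), ENNReal.ofReal_sub _ ENNReal.toReal_nonneg, ← hpr,
      ENNReal.ofReal_one]
  · intro n hn
    rw [Nat.choose_eq_zero_of_lt (Finset.mem_range.1 hn)]
    simp

lemma tsum_measure_slotsUntil (hA : ∀ k, MeasurableSet {ω | k ∈ A ω})
    (hind : iIndepSet (fun k => {ω | k ∈ A ω}) P) (hp : ∀ k, P {ω | k ∈ A ω} = p)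
    (hp0 : p ≠ 0) (k : ℕ) :
    ∑' n : ℕ, P {ω | slotsUntil (A ω) (k + 1) = n} = 1 := by
  have hp1 : p ≤ 1 := hp 0 ▸ prob_le_one
  have hpt : p ≠ ⊤ := ne_top_of_le_ne_top ENNReal.one_ne_top hp1
  have hpr0 : 0 < p.toReal := ENNReal.toReal_pos hp0 hpt
  have hpr1 : p.toReal ≤ 1 := ENNReal.toReal_le_of_le_ofReal zero_le_one (by simpa using hp1)
  have := tsum_mul_measure_slotsUntil hA hind hp k fun _ => 1
  simp only [one_mul] at this
  rw [this, tsum_choose_mul_pow_sub hpr0 hpr1, div_self (by positivity), ENNReal.ofReal_one]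

/-- The mean of the waiting time for the `(k + 1)`-st success. -/
lemma lintegral_slotsUntil (hA : ∀ k, MeasurableSet {ω | k ∈ A ω})
    (hind : iIndepSet (fun k => {ω | k ∈ A ω}) P) (hp : ∀ k, P {ω | k ∈ A ω} = p)
    (hp0 : p ≠ 0) (k : ℕ) :
    ∫⁻ ω, (slotsUntil (A ω) (k + 1) : ℝ≥0∞) ∂P = (k + 1 : ℕ) * p⁻¹ := by
  have hp1 : p ≤ 1 := hp 0 ▸ prob_le_one
  have hpt : p ≠ ⊤ := ne_top_of_le_ne_top ENNReal.one_ne_top hp1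
  have hpr0 : 0 < p.toReal := ENNReal.toReal_pos hp0 hpt
  have hpr1 : p.toReal ≤ 1 := ENNReal.toReal_le_of_le_ofReal zero_le_one (by simpa using hp1)
  rw [lintegral_enat (measurable_slotsUntil hA (k + 1))
    (tsum_measure_slotsUntil hA hind hp hp0 k) fun n => (n : ℝ≥0∞)]
  simp_rw [ENat.toENNReal_coe]
  rw [tsum_mul_measure_slotsUntil hA hind hp k fun n => (n : ℝ≥0∞)]
  -- Absorption: `(m+k+1) * C(m+k, k) = (k+1) * C(m+k+1, k+1)`.
  have h1 : ∀ m : ℕ, ((m + k + 1 : ℕ) : ℝ≥0∞) *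
      ENNReal.ofReal ((m + k).choose k * (p.toReal ^ (k + 1) * (1 - p.toReal) ^ m)) =
      (k + 1 : ℕ) * ENNReal.ofReal ((m + (k + 1)).choose (k + 1) *
        (p.toReal ^ (k + 1) * (1 - p.toReal) ^ m)) := by
    intro m
    rw [← ENNReal.ofReal_natCast, ← ENNReal.ofReal_natCast, ← ENNReal.ofReal_mul (by positivity),
      ← ENNReal.ofReal_mul (by positivity)]
    congr 1
    have h2 : ((m + k + 1 : ℕ) : ℝ) * ((m + k).choose k : ℕ) =
        ((m + (k + 1)).choose (k + 1) : ℕ) * ((k + 1 : ℕ) : ℝ) := by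
      exact_mod_cast Nat.add_one_mul_choose_eq (m + k) k
    linear_combination (p.toReal ^ (k + 1) * (1 - p.toReal) ^ m) * h2
  simp_rw [h1]
  rw [ENNReal.tsum_mul_left, tsum_choose_mul_pow_sub hpr0 hpr1,
    show p.toReal ^ (k + 1) / p.toReal ^ (k + 1 + 1) = p.toReal⁻¹ by field_simp; ring,
    ENNReal.ofReal_inv_of_pos hpr0, ENNReal.ofReal_toReal hpt]

/-- The second factorial moment of the waiting time for the `(k + 1)`-st success. -/
lemma lintegral_slotsUntil_mul_add_one (hA : ∀ k, MeasurableSet {ω | k ∈ A ω})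
    (hind : iIndepSet (fun k => {ω | k ∈ A ω}) P) (hp : ∀ k, P {ω | k ∈ A ω} = p)
    (hp0 : p ≠ 0) (k : ℕ) :
    ∫⁻ ω, (slotsUntil (A ω) (k + 1) : ℝ≥0∞) * ((slotsUntil (A ω) (k + 1) : ℝ≥0∞) + 1) ∂P =
      ((k + 1) * (k + 2) : ℕ) * p⁻¹ ^ 2 := by
  have hp1 : p ≤ 1 := hp 0 ▸ prob_le_one
  have hpt : p ≠ ⊤ := ne_top_of_le_ne_top ENNReal.one_ne_top hp1
  have hpr0 : 0 < p.toReal := ENNReal.toReal_pos hp0 hpt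
  have hpr1 : p.toReal ≤ 1 := ENNReal.toReal_le_of_le_ofReal zero_le_one (by simpa using hp1)
  rw [lintegral_enat (measurable_slotsUntil hA (k + 1))
    (tsum_measure_slotsUntil hA hind hp hp0 k) fun n => (n : ℝ≥0∞) * ((n : ℝ≥0∞) + 1)]
  simp_rw [ENat.toENNReal_coe]
  rw [tsum_mul_measure_slotsUntil hA hind hp k fun n => (n : ℝ≥0∞) * ((n : ℝ≥0∞) + 1)]
  -- The rising product `n (n + 1)` is absorbed by two successive binomial identities, which is why
  -- it is used in place of `n²`.
  have h1 : ∀ m : ℕ, ((m + k + 1 : ℕ) : ℝ≥0∞) * (((m + k + 1 : ℕ) : ℝ≥0∞) + 1) *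
      ENNReal.ofReal ((m + k).choose k * (p.toReal ^ (k + 1) * (1 - p.toReal) ^ m)) =
      ((k + 1) * (k + 2) : ℕ) * ENNReal.ofReal ((m + (k + 2)).choose (k + 2) *
        (p.toReal ^ (k + 1) * (1 - p.toReal) ^ m)) := by
    intro m
    rw [← Nat.cast_succ, ← Nat.cast_mul, ← ENNReal.ofReal_natCast,
      ← ENNReal.ofReal_natCast, ← ENNReal.ofReal_mul (by positivity),
      ← ENNReal.ofReal_mul (by positivity)]
    congr 1
    have h2 := Nat.add_one_mul_choose_eq (m + k) k
    have h3 := Nat.add_one_mul_choose_eq (m + k + 1) (k + 1)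
    have h4 : (m + k + 1) * (m + k + 1 + 1) * (m + k).choose k =
        (k + 1) * (k + 2) * (m + (k + 2)).choose (k + 2) := by
      rw [show m + (k + 2) = m + k + 1 + 1 by ring, show k + 2 = k + 1 + 1 by ring]
      calc (m + k + 1) * (m + k + 1 + 1) * (m + k).choose k
          = (m + k + 1 + 1) * ((m + k + 1) * (m + k).choose k) := by ring
        _ = (k + 1) * ((m + k + 1 + 1) * (m + k + 1).choose (k + 1)) := by rw [h2]; ring
        _ = _ := by rw [h3]; ring
    have h5 : (((m + k + 1) * (m + k + 1 + 1) : ℕ) : ℝ) * ((m + k).choose k : ℕ) =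
        (((k + 1) * (k + 2) : ℕ) : ℝ) * ((m + (k + 2)).choose (k + 2) : ℕ) := by
      exact_mod_cast h4
    linear_combination (p.toReal ^ (k + 1) * (1 - p.toReal) ^ m) * h5
  simp_rw [h1]
  rw [ENNReal.tsum_mul_left, tsum_choose_mul_pow_sub hpr0 hpr1,
    show p.toReal ^ (k + 1) / p.toReal ^ (k + 2 + 1) = p.toReal⁻¹ ^ 2 by field_simp; ring,
    ENNReal.ofReal_pow (by positivity), ENNReal.ofReal_inv_of_pos hpr0, ENNReal.ofReal_toReal hpt]

end Bernoulli

/-! ### Independence -/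

section Independence

variable {Ω : Type*} [mΩ : MeasurableSpace Ω] {P : Measure Ω}

/-- The σ-algebras generated by disjoint groups of independent σ-algebras are independent. -/
lemma iIndep_iSup_of_pairwise_disjoint {ι κ : Type*} {m : ι → MeasurableSpace Ω}
    (hle : ∀ i, m i ≤ mΩ) (hm : iIndep m P) {T : κ → Set ι}
    (hT : Pairwise fun k l => Disjoint (T k) (T l)) :
    iIndep (fun k => ⨆ i ∈ T k, m i) P := by
  classical
  rw [iIndep_iff]
  intro s f
  induction s using Finset.induction_on with
  | empty =>
    intro _
    have := hm.isProbabilityMeasure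
    simp
  | insert a s ha ih =>
    intro hf
    rw [Finset.prod_insert ha, ← ih fun i hi => hf i (Finset.mem_insert_of_mem hi),
      Finset.set_biInter_insert]
    have hdisj : Disjoint (T a) (⋃ k ∈ s, T k) := by
      rw [Set.disjoint_iUnion₂_right]
      exact fun k hk => hT fun h => ha (h ▸ hk)
    refine (Indep_iff _ _ _).1 (indep_iSup_of_disjoint hle hm hdisj) _ _
      (hf a (Finset.mem_insert_self a s)) ?_
    refine Finset.measurableSet_biInter s fun k hk => ?_
    refine (?_ : (⨆ i ∈ T k, m i) ≤ ⨆ i ∈ ⋃ k ∈ s, T k, m i) _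
      (hf k (Finset.mem_insert_of_mem hk))
    exact biSup_mono fun i hi => Set.mem_biUnion hk hi

/-- Two independent families of independent random variables form an independent family. -/
lemma iIndep_sum_elim {ι ι' E F : Type*} [MeasurableSpace E] [MeasurableSpace F]
    {f : ι → Ω → E} {g : ι' → Ω → F} (hf : iIndepFun f P) (hg : iIndepFun g P)
    (hfg : IndepFun (fun ω i => f i ω) (fun ω i => g i ω) P) :
    iIndep (Sum.elim (fun i => MeasurableSpace.comap (f i) inferInstance)
      fun i => MeasurableSpace.comap (g i) inferInstance) P := by
  rw [iIndep_iff]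
  intro s t ht
  have hle : ∀ i, MeasurableSpace.comap (f i) inferInstance ≤
      MeasurableSpace.comap (fun ω i => f i ω) inferInstance := by
    rintro i _ ⟨s, hs, rfl⟩
    exact ⟨(fun z => z i) ⁻¹' s, measurable_pi_apply i hs, rfl⟩
  have hle' : ∀ i, MeasurableSpace.comap (g i) inferInstance ≤
      MeasurableSpace.comap (fun ω i => g i ω) inferInstance := by
    rintro i _ ⟨s, hs, rfl⟩
    exact ⟨(fun z => z i) ⁻¹' s, measurable_pi_apply i hs, rfl⟩
  have hs : ⋂ i ∈ s, t i =
      (⋂ i ∈ s.toLeft, t (Sum.inl i)) ∩ ⋂ i ∈ s.toRight, t (Sum.inr i) := by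
    ext ω
    simp
  have hl : ∀ i ∈ s.toLeft,
      MeasurableSet[MeasurableSpace.comap (f i) inferInstance] (t (Sum.inl i)) :=
    fun i hi => ht _ (Finset.mem_toLeft.1 hi)
  have hr : ∀ i ∈ s.toRight,
      MeasurableSet[MeasurableSpace.comap (g i) inferInstance] (t (Sum.inr i)) :=
    fun i hi => ht _ (Finset.mem_toRight.1 hi)
  rw [hs, (Indep_iff _ _ _).1 hfg _ _
    (Finset.measurableSet_biInter _ fun i hi => hle i _ (hl i hi))
    (Finset.measurableSet_biInter _ fun i hi => hle' i _ (hr i hi)),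
    iIndepFun.meas_biInter hf hl, iIndepFun.meas_biInter hg hr]
  conv_rhs => rw [← Finset.toLeft_disjSum_toRight (u := s), Finset.prod_disjSum]

/-- Laplace transform of a series of independent random variables. -/
lemma lintegral_inv_expE_tsum [IsProbabilityMeasure P] {Z : ℕ → Ω → ℝ≥0∞}
    (hZ : ∀ i, Measurable (Z i))
    (hind : iIndepFun Z P) {g : ℕ → ℝ≥0∞}
    (hg : ∀ i, ∫⁻ ω, (expE (Z i ω))⁻¹ ∂P = (expE (g i))⁻¹) :
    ∫⁻ ω, (expE (∑' i, Z i ω))⁻¹ ∂P = (expE (∑' i, g i))⁻¹ := by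
  have hcont : Continuous fun t : ℝ≥0∞ => (expE t)⁻¹ := continuous_expE.inv
  have hfin : ∀ z : ℕ → ℝ≥0∞, ∀ n, (expE (∑ i ∈ Finset.range n, z i))⁻¹ =
      ∏ i ∈ Finset.range n, (expE (z i))⁻¹ := by
    intro z n
    rw [expE_sum, ENNReal.prod_inv_distrib]
    exact fun i _ j _ _ => Or.inl (expE_ne_zero _)
  -- Dominated convergence with bound `1`. Continuity of `t ↦ (expE t)⁻¹` at `⊤` covers divergent
  -- series.
  have h1 : Filter.Tendsto (fun n => ∫⁻ ω, (expE (∑ i ∈ Finset.range n, Z i ω))⁻¹ ∂P)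
      Filter.atTop (nhds (∫⁻ ω, (expE (∑' i, Z i ω))⁻¹ ∂P)) := by
    refine tendsto_lintegral_of_dominated_convergence (fun _ => 1) (fun n => ?_) (fun n => ?_)
      (by simp) ?_
    · exact hcont.measurable.comp (Finset.measurable_fun_sum _ fun i _ => hZ i)
    · exact Filter.Eventually.of_forall fun ω => ENNReal.inv_le_one.2 (one_le_expE _)
    · exact Filter.Eventually.of_forall fun ω =>
        (hcont.tendsto _).comp (ENNReal.tendsto_nat_tsum fun i => Z i ω)
  have h2 : Filter.Tendsto (fun n => (expE (∑ i ∈ Finset.range n, g i))⁻¹)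
      Filter.atTop (nhds (expE (∑' i, g i))⁻¹) :=
    (hcont.tendsto _).comp (ENNReal.tendsto_nat_tsum g)
  refine tendsto_nhds_unique h1 (h2.congr fun n => ?_)
  simp_rw [hfin]
  rw [lintegral_prod_eq_prod_lintegral_of_indepFun _ (fun i ω => (expE (Z i ω))⁻¹)
    (hind.comp (fun _ t => (expE t)⁻¹) fun _ => hcont.measurable)
    fun i => hcont.measurable.comp (hZ i)]
  exact Finset.prod_congr rfl fun i _ => (hg i).symm

end Independence

/-! ### The exponential distribution -/

section Exponential

instance : IsProbabilityMeasure (expMeasure 1) := isProbabilityMeasure_expMeasure one_pos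

lemma expMeasure_setOf_lt_ofReal (t : ℝ≥0∞) :
    expMeasure 1 {y | t < ENNReal.ofReal y} = (expE t)⁻¹ := by
  induction t using ENNReal.recTopCoe with
  | top => simp
  | coe t =>
    have h1 : {y : ℝ | (t : ℝ≥0∞) < ENNReal.ofReal y} = (Set.Iic (t : ℝ))ᶜ := by
      ext y
      rw [← ENNReal.ofReal_coe_nnreal]
      simp only [Set.mem_ofPred_eq, Set.mem_compl_iff, Set.mem_Iic, not_le]
      constructor
      · intro h
        by_contra h'
        exact absurd (ENNReal.ofReal_le_ofReal (not_lt.1 h')) (not_le.2 h)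
      · intro h
        exact (ENNReal.ofReal_lt_ofReal_iff (t.coe_nonneg.trans_lt h)).2 h
    rw [h1, prob_compl_eq_one_sub measurableSet_Iic, ← ofReal_cdf, cdf_expMeasure_eq one_pos,
      if_pos t.coe_nonneg, ← ENNReal.ofReal_one, ← ENNReal.ofReal_sub, ← ENNReal.ofReal_coe_nnreal,
      expE_ofReal t.coe_nonneg, ← ENNReal.ofReal_inv_of_pos (Real.exp_pos _), ← Real.exp_neg]
    · congr 1
      simp
    · simp

lemma lintegral_expMeasure {F : ℝ → ℝ≥0∞} (hF : Measurable F) :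
    ∫⁻ y, F y ∂expMeasure 1 = ∫⁻ y in Set.Ioi (0 : ℝ), ENNReal.ofReal (Real.exp (-y)) * F y := by
  have h1 : ∀ y, gammaPDF 1 1 y = exponentialPDF 1 y := fun y => rfl
  rw [expMeasure, gammaMeasure, lintegral_withDensity_eq_lintegral_mul _
    (show Measurable (gammaPDF 1 1) from (measurable_gammaPDFReal 1 1).ennreal_ofReal) hF, ← setLIntegral_univ,
    ← Set.Iio_union_Ici (a := (0 : ℝ)), lintegral_union measurableSet_Ici
    (Set.Iio_disjoint_Ici le_rfl), setLIntegral_congr (Ioi_ae_eq_Ici (a := (0 : ℝ))).symm]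
  rw [setLIntegral_congr_fun (g := fun _ => 0) measurableSet_Iio, lintegral_zero, zero_add]
  · refine setLIntegral_congr_fun measurableSet_Ioi fun y hy => ?_
    have hy : 0 < y := hy
    rw [Pi.mul_apply, h1, exponentialPDF_of_nonneg hy.le]
    simp
  · intro y hy
    simp only [Pi.mul_apply]
    rw [h1, exponentialPDF_of_neg hy, zero_mul]

/-- The Laplace transform of the unit exponential law; the value `u = ⊤` allows for an interferer at
the origin. -/
lemma lintegral_inv_expE_ofReal_mul (u : ℝ≥0∞) :
    ∫⁻ y, (expE (ENNReal.ofReal y * u))⁻¹ ∂expMeasure 1 = (1 + u)⁻¹ := by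
  rw [lintegral_expMeasure]
  · induction u using ENNReal.recTopCoe with
    | top =>
      rw [setLIntegral_congr_fun (g := fun _ => 0) measurableSet_Ioi]
      · simp
      · intro y hy
        have hy : 0 < y := hy
        simp only
        rw [ENNReal.mul_top (by simpa using hy)]
        simp
    | coe u =>
      rw [← ENNReal.ofReal_coe_nnreal]
      have h1 : (0 : ℝ) < 1 + u := by positivity
      rw [setLIntegral_congr_fun (g := fun y => ENNReal.ofReal
        (y ^ ((1 : ℝ) - 1) * Real.exp (-(1 + u) * y))) measurableSet_Ioi,
        lintegral_rpow_sub_one_mul_exp_neg_mul one_pos h1, Real.Gamma_one, mul_one,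
        Real.rpow_neg_one, ENNReal.ofReal_inv_of_pos h1, ENNReal.ofReal_add zero_le_one u.coe_nonneg,
        ENNReal.ofReal_one]
      intro y hy
      have hy : 0 < y := hy
      simp only
      rw [← ENNReal.ofReal_mul hy.le, expE_ofReal (by positivity),
        ← ENNReal.ofReal_inv_of_pos (Real.exp_pos _), ← ENNReal.ofReal_mul (Real.exp_nonneg _),
        ← Real.exp_neg, ← Real.exp_add, sub_self, Real.rpow_zero, one_mul]
      congr 2
      ring
  · exact (measurable_expE.comp (ENNReal.measurable_ofReal.mul_const u)).inv

end Exponential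

/-! ### Success of a slot for given locations -/

section Measurability

variable {Ω : Type*} [MeasurableSpace Ω] {d N : ℕ} {α θ r₀ W N₀ : ℝ}
  {X : ℕ → Ω → EuclideanSpace ℝ (Fin d)} {h : ℕ → Option ℕ → Ω → ℝ}
  {S : ℕ → Option ℕ → Ω → Fin N} {k : ℕ}

lemma measurable_interference (hX : ∀ i, Measurable (X i)) (hh : ∀ o, Measurable (h k o))
    (hS : ∀ o, Measurable (S k o)) : Measurable (interference α X h S k) := by
  refine Measurable.tsum fun i => ?_
  refine Measurable.ite (measurableSet_eq_fun (hS _) (hS _)) ?_ measurable_const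
  exact (hh _).ennreal_ofReal.mul ((hX i).enorm.pow_const _)

lemma measurableSet_success (hX : ∀ i, Measurable (X i)) (hh : ∀ o, Measurable (h k o))
    (hS : ∀ o, Measurable (S k o)) :
    MeasurableSet {ω | k ∈ successSlots α θ r₀ W N₀ X h S ω} := by
  have hs : Measurable (sinr α r₀ W N₀ X h S k) := ((hh none).mul_const _).ennreal_ofReal.div
    (measurable_const.add (measurable_interference hX hh hS))
  exact measurableSet_lt measurable_const hs

lemma measurable_ite_band {H : Ω → ℝ} {B : Ω → Fin N} (hH : Measurable H) (hB : Measurable B)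
    (s : Fin N) (u : ℝ≥0∞) :
    Measurable fun ω => if B ω = s then ENNReal.ofReal (H ω) * u else 0 :=
  Measurable.ite (hB (measurableSet_singleton s)) (hH.ennreal_ofReal.mul_const u) measurable_const

end Measurability

lemma mem_successSlots_iff {Ω : Type*} {d N : ℕ} {α θ r₀ W N₀ : ℝ} (hθ : 0 < θ) (hr₀ : 0 < r₀)
    (X : ℕ → Ω → EuclideanSpace ℝ (Fin d)) (h : ℕ → Option ℕ → Ω → ℝ)
    (S : ℕ → Option ℕ → Ω → Fin N) (k : ℕ) (ω : Ω) :
    k ∈ successSlots α θ r₀ W N₀ X h S ω ↔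
      ENNReal.ofReal (θ * r₀ ^ α) * (ENNReal.ofReal (W * N₀ / N) + interference α X h S k ω) <
        ENNReal.ofReal (h k none ω) := by
  have hr : 0 < r₀ ^ α := Real.rpow_pos_of_pos hr₀ α
  have h1 : ENNReal.ofReal (h k none ω) =
      ENNReal.ofReal (r₀ ^ α) * ENNReal.ofReal (h k none ω * r₀ ^ (-α)) := by
    rw [← ENNReal.ofReal_mul hr.le, Real.rpow_neg hr₀.le]
    congr 1
    field_simp
  rw [h1, mul_comm θ, ENNReal.ofReal_mul hr.le, mul_assoc,
    ENNReal.mul_lt_mul_iff_right (by simpa using hr) ENNReal.ofReal_ne_top]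
  -- The denominator may be `0` or `⊤`; cross multiplication stays valid because the threshold is
  -- finite and nonzero.
  exact ENNReal.lt_div_iff_mul_lt (Or.inr ENNReal.ofReal_ne_top) (Or.inr (by simpa using hθ))

/-- Conditioning on `T` leaves the exponential tail `e^(-T)`. This is where Rayleigh fading turns a
success probability into a Laplace transform. -/
lemma measure_lt_ofReal_of_indepFun {Ω : Type*} [MeasurableSpace Ω] {P : Measure Ω}
    [IsProbabilityMeasure P] {T : Ω → ℝ≥0∞} {H : Ω → ℝ} (hT : Measurable T) (hH : Measurable H)
    (hind : IndepFun T H P) (hlaw : P.map H = expMeasure 1) :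
    P {ω | T ω < ENNReal.ofReal (H ω)} = ∫⁻ ω, (expE (T ω))⁻¹ ∂P := by
  have hm : MeasurableSet {z : ℝ≥0∞ × ℝ | z.1 < ENNReal.ofReal z.2} :=
    measurableSet_lt measurable_fst measurable_snd.ennreal_ofReal
  have h1 := (indepFun_iff_map_prod_eq_prod_map_map hT.aemeasurable hH.aemeasurable).1 hind
  calc P {ω | T ω < ENNReal.ofReal (H ω)}
      = P.map (fun ω => (T ω, H ω)) {z | z.1 < ENNReal.ofReal z.2} := by
        rw [Measure.map_apply (hT.prodMk hH) hm]
        rfl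
    _ = ∫⁻ t, expMeasure 1 {y | t < ENNReal.ofReal y} ∂P.map T := by
        rw [h1, hlaw, Measure.prod_apply hm]
        rfl
    _ = ∫⁻ ω, (expE (T ω))⁻¹ ∂P := by
        simp_rw [expMeasure_setOf_lt_ofReal]
        exact lintegral_map continuous_expE.inv.measurable hT

section MarkSigma

variable {Ω : Type*} {N : ℕ} {h : ℕ → Option ℕ → Ω → ℝ} {S : ℕ → Option ℕ → Ω → Fin N}

/-- The σ-algebras generated by the fading coefficients and by the sub-bands. -/
@[reducible]
def markSigma (h : ℕ → Option ℕ → Ω → ℝ) (S : ℕ → Option ℕ → Ω → Fin N) :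
    (ℕ × Option ℕ) ⊕ (ℕ × Option ℕ) → MeasurableSpace Ω :=
  Sum.elim (fun p => MeasurableSpace.comap (h p.1 p.2) inferInstance)
    fun p => MeasurableSpace.comap (S p.1 p.2) inferInstance

lemma measurable_fading_iSup {T : Set ((ℕ × Option ℕ) ⊕ (ℕ × Option ℕ))} {k : ℕ} {o : Option ℕ}
    (hT : Sum.inl (k, o) ∈ T) : Measurable[⨆ i ∈ T, markSigma h S i] (h k o) := by
  rw [measurable_iff_comap_le]
  exact le_biSup (markSigma h S) hT

lemma measurable_band_iSup {T : Set ((ℕ × Option ℕ) ⊕ (ℕ × Option ℕ))} {k : ℕ} {o : Option ℕ}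
    (hT : Sum.inr (k, o) ∈ T) : Measurable[⨆ i ∈ T, markSigma h S i] (S k o) := by
  rw [measurable_iff_comap_le]
  exact le_biSup (markSigma h S) hT

end MarkSigma

section Marks

variable {Ω : Type*} [mΩ : MeasurableSpace Ω] {P : Measure Ω} {d N : ℕ} {lam α θ r₀ W N₀ : ℝ}
  {X : ℕ → Ω → EuclideanSpace ℝ (Fin d)} {h : ℕ → Option ℕ → Ω → ℝ}
  {S : ℕ → Option ℕ → Ω → Fin N}

lemma IsNetwork.iIndep_markSigma (hnet : IsNetwork P lam X h S) : iIndep (markSigma h S) P :=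
  iIndep_sum_elim hnet.fading_iIndep hnet.band_iIndep hnet.fading_band_indep

lemma IsNetwork.markSigma_le (hnet : IsNetwork P lam X h S) (i) : markSigma h S i ≤ mΩ := by
  rcases i with p | p
  · exact (hnet.measurable_fading p.1 p.2).comap_le
  · exact (hnet.measurable_band p.1 p.2).comap_le

lemma IsNetwork.iSup_markSigma_le (hnet : IsNetwork P lam X h S)
    (T : Set ((ℕ × Option ℕ) ⊕ (ℕ × Option ℕ))) : ⨆ i ∈ T, markSigma h S i ≤ mΩ :=
  iSup₂_le fun i _ => hnet.markSigma_le i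

/-- For given locations, the successes in the different slots are independent. -/
lemma IsNetwork.iIndepSet_success (hnet : IsNetwork P lam X h S)
    (x : ℕ → EuclideanSpace ℝ (Fin d)) :
    iIndepSet (fun k => {ω | k ∈ successSlots α θ r₀ W N₀ (fun i _ => x i) h S ω}) P := by
  have hind := iIndep_iSup_of_pairwise_disjoint hnet.markSigma_le hnet.iIndep_markSigma
    -- The marks, fading and bands together, are grouped by time slot.
    (T := fun k : ℕ => {i | Sum.elim Prod.fst Prod.fst i = k}) (fun k l hkl => by
      refine Set.disjoint_left.2 ?_
      rintro i rfl hi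
      exact hkl hi)
  rw [iIndepSet_iff_meas_biInter fun k => measurableSet_success (fun i => measurable_const)
    (hnet.measurable_fading k) (hnet.measurable_band k)]
  intro s
  refine iIndep.meas_biInter hind fun k _ => ?_
  refine @measurableSet_success Ω (_) d N α θ r₀ W N₀ _ h S k ?_ ?_ ?_
  · exact fun i => @measurable_const _ _ _ (_) _
  · exact fun o => measurable_fading_iSup rfl
  · exact fun o => measurable_band_iSup rfl

variable [IsProbabilityMeasure P]

/-- Split according to whether the interferer uses band `s`: if not, the factor is `1`; if so,
independence of band and fading gives `1/N` times the exponential transform. -/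
lemma IsNetwork.lintegral_inv_expE_ite_band (hnet : IsNetwork P lam X h S) (k i : ℕ) (s : Fin N)
    (u : ℝ≥0∞) :
    ∫⁻ ω, (expE (if S k (some i) ω = s then ENNReal.ofReal (h k (some i) ω) * u else 0))⁻¹ ∂P =
      (1 - (N : ℝ≥0∞)⁻¹) + (N : ℝ≥0∞)⁻¹ * (1 + u)⁻¹ := by
  set E : Set Ω := {ω | S k (some i) ω = s} with hE
  have hEm : MeasurableSet E := hnet.measurable_band k (some i) (measurableSet_singleton s)
  have hPE : P E = (N : ℝ≥0∞)⁻¹ := hnet.band_law k (some i) s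
  have hφ : Measurable fun y : ℝ => (expE (ENNReal.ofReal y * u))⁻¹ :=
    (measurable_expE.comp (ENNReal.measurable_ofReal.mul_const u)).inv
  have h1 : ∀ ω, (expE (if S k (some i) ω = s then ENNReal.ofReal (h k (some i) ω) * u
      else 0))⁻¹ = Eᶜ.indicator 1 ω +
        E.indicator 1 ω * (expE (ENNReal.ofReal (h k (some i) ω) * u))⁻¹ := by
    intro ω
    by_cases hω : S k (some i) ω = s
    · have : ω ∈ E := hω
      simp [this, hω]
    · have : ω ∉ E := hω
      simp [this, hω]
  have hind : Indep (⨆ j ∈ ({Sum.inr (k, some i)} : Set _), markSigma h S j)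
      (⨆ j ∈ ({Sum.inl (k, some i)} : Set _), markSigma h S j) P :=
    indep_iSup_of_disjoint hnet.markSigma_le hnet.iIndep_markSigma (by simp)
  simp_rw [h1]
  rw [lintegral_add_left (measurable_one.indicator hEm.compl), lintegral_indicator_one hEm.compl,
    prob_compl_eq_one_sub hEm, hPE,
    lintegral_mul_eq_lintegral_mul_lintegral_of_independent_measurableSpace
      (hnet.iSup_markSigma_le _) (hnet.iSup_markSigma_le _) hind, lintegral_indicator_one hEm, hPE]
  · congr 2
    rw [← lintegral_inv_expE_ofReal_mul, ← hnet.fading_law k (some i),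
      lintegral_map hφ (hnet.measurable_fading k (some i))]
  · refine @Measurable.indicator _ _ (_) _ _ _ _ (@measurable_one _ _ _ (_) _) ?_
    exact measurable_band_iSup (T := {Sum.inr (k, some i)}) rfl (measurableSet_singleton s)
  · exact hφ.comp (measurable_fading_iSup (T := {Sum.inl (k, some i)}) rfl)

lemma IsNetwork.lintegral_inv_expE_tsum_band (hnet : IsNetwork P lam X h S) (k : ℕ) (s : Fin N)
    (u : ℕ → ℝ≥0∞) {g : ℕ → ℝ≥0∞}
    (hg : ∀ i, (1 - (N : ℝ≥0∞)⁻¹) + (N : ℝ≥0∞)⁻¹ * (1 + u i)⁻¹ = (expE (g i))⁻¹) :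
    ∫⁻ ω, (expE (∑' i, if S k (some i) ω = s then ENNReal.ofReal (h k (some i) ω) * u i
      else 0))⁻¹ ∂P = (expE (∑' i, g i))⁻¹ := by
  refine lintegral_inv_expE_tsum
    (Z := fun i ω => if S k (some i) ω = s then ENNReal.ofReal (h k (some i) ω) * u i else 0)
    (fun i => measurable_ite_band (hnet.measurable_fading _ _) (hnet.measurable_band _ _) s _)
    ?_ fun i => by rw [hnet.lintegral_inv_expE_ite_band, hg]
  have hind := iIndep_iSup_of_pairwise_disjoint hnet.markSigma_le hnet.iIndep_markSigma
    (T := fun i : ℕ => {Sum.inl (k, some i), Sum.inr (k, some i)}) (fun i j hij => by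
      simp [Ne.symm hij])
  rw [iIndepFun_iff]
  intro t f ht
  refine iIndep.meas_biInter hind fun i hi => ?_
  refine (?_ : MeasurableSpace.comap _ _ ≤ _) _ (ht i hi)
  rw [← measurable_iff_comap_le]
  exact @measurable_ite_band Ω (_) N _ _ (measurable_fading_iSup (by simp))
    (measurable_band_iSup (by simp)) s (u i)

/-- The desired band is random and shared by all indicators, so the terms are handled after
conditioning on it. The transform does not depend on its value `s`, and the `N` weights `1/N` add up
to one. -/
lemma IsNetwork.lintegral_inv_expE_tsum_same_band (hnet : IsNetwork P lam X h S) (hN : N ≠ 0)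
    (k : ℕ) (u : ℕ → ℝ≥0∞) {g : ℕ → ℝ≥0∞}
    (hg : ∀ i, (1 - (N : ℝ≥0∞)⁻¹) + (N : ℝ≥0∞)⁻¹ * (1 + u i)⁻¹ = (expE (g i))⁻¹) :
    ∫⁻ ω, (expE (∑' i, if S k (some i) ω = S k none ω then ENNReal.ofReal (h k (some i) ω) * u i
      else 0))⁻¹ ∂P = (expE (∑' i, g i))⁻¹ := by
  set Y : Fin N → Ω → ℝ≥0∞ := fun s ω => (expE (∑' i, if S k (some i) ω = s then
    ENNReal.ofReal (h k (some i) ω) * u i else 0))⁻¹ with hY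
  have h1 : ∀ ω, (expE (∑' i, if S k (some i) ω = S k none ω then
      ENNReal.ofReal (h k (some i) ω) * u i else 0))⁻¹ =
      ∑ s : Fin N, {ω | S k none ω = s}.indicator 1 ω * Y s ω := by
    intro ω
    rw [Finset.sum_eq_single (S k none ω)]
    · simp [hY]
    · intro s _ hs
      rw [Set.indicator_of_notMem, zero_mul]
      exact fun h' => hs h'.symm
    · simp
  have hYm : ∀ (m : MeasurableSpace Ω), (∀ i, Measurable[m] (h k (some i))) →
      (∀ i, Measurable[m] (S k (some i))) → ∀ s, Measurable[m] (Y s) := by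
    intro m hm1 hm2 s
    exact continuous_expE.inv.measurable.comp (Measurable.tsum fun i =>
      measurable_ite_band (hm1 i) (hm2 i) s _)
  have hEm : ∀ s, MeasurableSet {ω | S k none ω = s} := fun s =>
    hnet.measurable_band k none (measurableSet_singleton s)
  have hind : Indep (⨆ j ∈ ({Sum.inr (k, none)} : Set _), markSigma h S j)
      (⨆ j ∈ ({Sum.inr (k, none)}ᶜ : Set _), markSigma h S j) P :=
    indep_iSup_of_disjoint hnet.markSigma_le hnet.iIndep_markSigma disjoint_compl_right
  simp_rw [h1]
  have h3 : ∀ s ∈ (Finset.univ : Finset (Fin N)),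
      Measurable fun ω => {ω | S k none ω = s}.indicator 1 ω * Y s ω := fun s _ =>
    (measurable_one.indicator (hEm s)).mul
      (hYm _ (fun i => hnet.measurable_fading _ _) (fun i => hnet.measurable_band _ _) s)
  rw [lintegral_finsetSum _ h3]
  have h2 : ∀ s : Fin N, ∫⁻ ω, {ω | S k none ω = s}.indicator 1 ω * Y s ω ∂P =
      (N : ℝ≥0∞)⁻¹ * (expE (∑' i, g i))⁻¹ := by
    intro s
    rw [lintegral_mul_eq_lintegral_mul_lintegral_of_independent_measurableSpace
      (hnet.iSup_markSigma_le _) (hnet.iSup_markSigma_le _) hind,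
      lintegral_indicator_one (hEm s), hnet.band_law, hY,
      hnet.lintegral_inv_expE_tsum_band k s u hg]
    · refine @Measurable.indicator _ _ (_) _ _ _ _ (@measurable_one _ _ _ (_) _) ?_
      exact measurable_band_iSup (T := {Sum.inr (k, none)}) rfl (measurableSet_singleton s)
    · exact hYm _ (fun i => measurable_fading_iSup (by simp))
        (fun i => measurable_band_iSup (by simp)) s
  simp_rw [h2]
  rw [Finset.sum_const, Finset.card_univ, Fintype.card_fin, nsmul_eq_mul, ← mul_assoc,
    ENNReal.mul_inv_cancel (by exact_mod_cast hN) (ENNReal.natCast_ne_top N), one_mul]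

/-- The success probability of a slot when the interferers are located at `x 0, x 1, …`. -/
noncomputable def successProb (N : ℕ) (α θ r₀ W N₀ : ℝ) (x : ℕ → EuclideanSpace ℝ (Fin d)) :
    ℝ≥0∞ :=
  (expE (ENNReal.ofReal (paramB α θ r₀ W N₀ / N) +
    ∑' i, logE (bandLaplace N (θ * r₀ ^ α) α (x i))⁻¹))⁻¹

lemma IsNetwork.measure_success (hnet : IsNetwork P lam X h S) (hN : N ≠ 0)
    (hθ : 0 < θ) (hr₀ : 0 < r₀) (x : ℕ → EuclideanSpace ℝ (Fin d)) (k : ℕ) :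
    P {ω | k ∈ successSlots α θ r₀ W N₀ (fun i _ => x i) h S ω} =
      successProb N α θ r₀ W N₀ x := by
  set T : Ω → ℝ≥0∞ := fun ω => ENNReal.ofReal (θ * r₀ ^ α) *
    (ENNReal.ofReal (W * N₀ / N) + interference α (fun i _ => x i) h S k ω) with hT
  have hTm : ∀ (m : MeasurableSpace Ω), (∀ i, Measurable[m] (h k (some i))) →
      (∀ o, Measurable[m] (S k o)) → Measurable[m] T := by
    intro m hm1 hm2
    have hI : Measurable[m] (interference α (fun i _ => x i) h S k) := Measurable.tsum fun i =>
      Measurable.ite (measurableSet_eq_fun (hm2 _) (hm2 _))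
        ((hm1 i).ennreal_ofReal.mul_const _) measurable_const
    exact (hI.const_add _).const_mul _
  have hc : 0 < θ * r₀ ^ α := mul_pos hθ (Real.rpow_pos_of_pos hr₀ α)
  -- `T` is measurable with respect to all marks other than the fading of the desired transmitter in
  -- slot `k`.
  have hind : IndepFun T (h k none) P := by
    refine indep_of_indep_of_le_left (indep_of_indep_of_le_right (indep_iSup_of_disjoint
      hnet.markSigma_le hnet.iIndep_markSigma
      (disjoint_compl_left (a := ({Sum.inl (k, none)} : Set _)))) ?_) ?_
    · exact measurable_iff_comap_le.1 (measurable_fading_iSup rfl)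
    · exact measurable_iff_comap_le.1 (hTm _ (fun i => measurable_fading_iSup (by simp))
        fun o => measurable_band_iSup (by simp))
  simp_rw [mem_successSlots_iff hθ hr₀]
  rw [measure_lt_ofReal_of_indepFun (T := T) (hTm _ (fun i => hnet.measurable_fading _ _)
    fun o => hnet.measurable_band _ _) (hnet.measurable_fading _ _) hind (hnet.fading_law _ _)]
  have h1 : ∀ ω, (expE (T ω))⁻¹ = (expE (ENNReal.ofReal (paramB α θ r₀ W N₀ / N)))⁻¹ *
      (expE (∑' i, if S k (some i) ω = S k none ω then ENNReal.ofReal (h k (some i) ω) *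
        (ENNReal.ofReal (θ * r₀ ^ α) * ‖x i‖ₑ ^ (-α)) else 0))⁻¹ := by
    intro ω
    rw [← ENNReal.mul_inv (Or.inl (expE_ne_zero _)) (Or.inr (expE_ne_zero _)), ← expE_add, hT]
    simp only
    rw [mul_add, ← ENNReal.ofReal_mul hc.le, interference, ← ENNReal.tsum_mul_left]
    congr 3
    · rw [paramB]
      congr 1
      ring
    · refine tsum_congr fun i => ?_
      split_ifs
      · ring
      · simp
  simp_rw [h1]
  rw [lintegral_const_mul', hnet.lintegral_inv_expE_tsum_same_band hN k
    (g := fun i => logE (bandLaplace N (θ * r₀ ^ α) α (x i))⁻¹), successProb, expE_add,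
    ENNReal.mul_inv (Or.inl (expE_ne_zero _)) (Or.inr (expE_ne_zero _))]
  · intro i
    rw [expE_logE, inv_inv]
    · rfl
    · rw [ENNReal.one_le_inv]
      exact bandLaplace_le_one (Nat.one_le_iff_ne_zero.2 hN) _ _ _
  · exact ENNReal.inv_ne_top.2 (expE_ne_zero _)

end Marks

/-! ### Conditioning on the locations -/

section Conditioning

variable {Ω E F : Type*} [MeasurableSpace Ω] [MeasurableSpace E] [MeasurableSpace F]
  {P : Measure Ω} [IsProbabilityMeasure P] {X : Ω → E} {Y : Ω → F}

lemma lintegral_prodMk_of_indepFun (hX : Measurable X) (hY : Measurable Y) (hXY : IndepFun X Y P)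
    {f : E × F → ℝ≥0∞} (hf : Measurable f) :
    ∫⁻ ω, f (X ω, Y ω) ∂P = ∫⁻ ω, ∫⁻ ω', f (X ω, Y ω') ∂P ∂P := by
  have h1 := (indepFun_iff_map_prod_eq_prod_map_map hX.aemeasurable hY.aemeasurable).1 hXY
  have : IsProbabilityMeasure (P.map Y) := Measure.isProbabilityMeasure_map hY.aemeasurable
  calc ∫⁻ ω, f (X ω, Y ω) ∂P = ∫⁻ z, f z ∂P.map (fun ω => (X ω, Y ω)) :=
        (lintegral_map hf (hX.prodMk hY)).symm
    _ = ∫⁻ x, ∫⁻ y, f (x, y) ∂P.map Y ∂P.map X := by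
        rw [h1, lintegral_prod _ hf.aemeasurable]
    _ = ∫⁻ ω, ∫⁻ y, f (X ω, y) ∂P.map Y ∂P := lintegral_map hf.lintegral_prod_right' hX
    _ = _ := by
        refine lintegral_congr fun ω => ?_
        exact lintegral_map (hf.comp measurable_prodMk_left) hY

/-- The conditional probability of an event which depends on `X` and on an independent `Y`. -/
lemma condExp_indicator_of_indepFun (hX : Measurable X) (hY : Measurable Y)
    (hXY : IndepFun X Y P) {G : Set (E × F)} (hG : MeasurableSet G) {q : E → ℝ≥0∞}
    (hq : ∀ x, P {ω | (x, Y ω) ∈ G} = q x) :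
    P⟦{ω | (X ω, Y ω) ∈ G} | MeasurableSpace.comap X inferInstance⟧ =ᵐ[P]
      fun ω => (q (X ω)).toReal := by
  have hle : MeasurableSpace.comap X inferInstance ≤ (inferInstance : MeasurableSpace Ω) :=
    hX.comap_le
  have hGm : MeasurableSet {ω | (X ω, Y ω) ∈ G} := hX.prodMk hY hG
  have : IsProbabilityMeasure (P.map Y) := Measure.isProbabilityMeasure_map hY.aemeasurable
  have hqm : Measurable q := by
    have : q = fun x => P.map Y (Prod.mk x ⁻¹' G) := by
      ext x
      rw [← hq, Measure.map_apply hY (measurable_prodMk_left hG)]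
      rfl
    rw [this]
    exact measurable_measure_prodMk_left hG
  have hq1 : ∀ x, q x ≤ 1 := fun x => hq x ▸ prob_le_one
  have hint : Integrable (fun ω => (q (X ω)).toReal) P := by
    refine Integrable.of_bound (hqm.comp hX).ennreal_toReal.aestronglyMeasurable 1
      (Filter.Eventually.of_forall fun ω => ?_)
    rw [Real.norm_eq_abs, abs_of_nonneg ENNReal.toReal_nonneg]
    exact ENNReal.toReal_le_of_le_ofReal zero_le_one (by simpa using hq1 (X ω))
  symm
  refine ae_eq_condExp_of_forall_setIntegral_eq hle ?_ ?_ ?_ ?_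
  · exact (integrable_const (1 : ℝ)).indicator hGm
  · exact fun s _ _ => hint.integrableOn
  -- Over `X ⁻¹' B` both integrals are the mass of `G ∩ (B × F)` under the product law, evaluated by
  -- Fubini.
  · rintro s ⟨B, hB, rfl⟩ -
    have hm : Measurable ((G ∩ Prod.fst ⁻¹' B).indicator (1 : E × F → ℝ≥0∞)) :=
      measurable_one.indicator (hG.inter (measurable_fst hB))
    have h1 := lintegral_prodMk_of_indepFun hX hY hXY hm
    have h2 : ∫⁻ ω, (G ∩ Prod.fst ⁻¹' B).indicator (1 : E × F → ℝ≥0∞) (X ω, Y ω) ∂P =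
        P ({ω | (X ω, Y ω) ∈ G} ∩ X ⁻¹' B) := by
      rw [← lintegral_indicator_one (hGm.inter (hX hB))]
      rfl
    have h3 : ∀ ω, ∫⁻ ω', (G ∩ Prod.fst ⁻¹' B).indicator (1 : E × F → ℝ≥0∞) (X ω, Y ω') ∂P =
        (X ⁻¹' B).indicator (fun ω => q (X ω)) ω := by
      intro ω
      by_cases hω : X ω ∈ B
      · rw [Set.indicator_of_mem (show ω ∈ X ⁻¹' B from hω), ← hq,
          ← lintegral_indicator_one
            (show MeasurableSet {ω' | (X ω, Y ω') ∈ G} from (measurable_const.prodMk hY) hG)]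
        refine lintegral_congr fun ω' => ?_
        by_cases hG' : (X ω, Y ω') ∈ G
        · rw [Set.indicator_of_mem (show (X ω, Y ω') ∈ G ∩ Prod.fst ⁻¹' B from ⟨hG', hω⟩),
            Set.indicator_of_mem (show ω' ∈ {ω' | (X ω, Y ω') ∈ G} from hG')]
          rfl
        · rw [Set.indicator_of_notMem fun h' => hG' h'.1,
            Set.indicator_of_notMem (show ω' ∉ {ω' | (X ω, Y ω') ∈ G} from hG')]
      · rw [Set.indicator_of_notMem (show ω ∉ X ⁻¹' B from hω)]
        simp [Set.indicator, hω]
    rw [h2] at h1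
    simp_rw [h3] at h1
    rw [lintegral_indicator (hX hB)] at h1
    rw [integral_toReal (f := fun ω => q (X ω)) (hqm.comp hX).aemeasurable (Filter.Eventually.of_forall fun ω =>
      (hq1 _).trans_lt ENNReal.one_lt_top), ← h1, integral_indicator hGm,
      Measure.restrict_restrict hGm]
    simp [Measure.real]
  · exact (Measurable.ennreal_toReal (hqm.comp (comap_measurable X))).aestronglyMeasurable

end Conditioning

section Network

variable {Ω : Type*} [MeasurableSpace Ω] {P : Measure Ω} {d N : ℕ} {lam α θ r₀ W N₀ : ℝ}
  {X : ℕ → Ω → EuclideanSpace ℝ (Fin d)} {h : ℕ → Option ℕ → Ω → ℝ}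
  {S : ℕ → Option ℕ → Ω → Fin N}

/-- The set of the successful slots as a function of the locations and of the marks. -/
def slotsOf (α θ r₀ W N₀ : ℝ)
    (z : (ℕ → EuclideanSpace ℝ (Fin d)) × (ℕ × Option ℕ → ℝ × Fin N)) : Set ℕ :=
  successSlots α θ r₀ W N₀ (fun i z => z.1 i) (fun k o z => (z.2 (k, o)).1)
    (fun k o z => (z.2 (k, o)).2) z

lemma measurableSet_slotsOf (k : ℕ) :
    MeasurableSet {z : (ℕ → EuclideanSpace ℝ (Fin d)) × (ℕ × Option ℕ → ℝ × Fin N) |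
      k ∈ slotsOf α θ r₀ W N₀ z} :=
  measurableSet_success (fun i => by fun_prop) (fun o => by fun_prop) fun o => by fun_prop

lemma IsNetwork.measurable_locations (hnet : IsNetwork P lam X h S) :
    Measurable fun ω i => X i ω :=
  measurable_pi_iff.2 hnet.isPoissonProcess.measurable

lemma IsNetwork.measurable_marks (hnet : IsNetwork P lam X h S) :
    Measurable fun ω (p : ℕ × Option ℕ) => (h p.1 p.2 ω, S p.1 p.2 ω) :=
  measurable_pi_iff.2 fun p =>
    (hnet.measurable_fading p.1 p.2).prodMk (hnet.measurable_band p.1 p.2)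

lemma IsNetwork.measurableSet_success_const (hnet : IsNetwork P lam X h S)
    (x : ℕ → EuclideanSpace ℝ (Fin d)) (k : ℕ) :
    MeasurableSet {ω | k ∈ successSlots α θ r₀ W N₀ (fun i _ => x i) h S ω} :=
  measurableSet_success (fun _ => measurable_const) (hnet.measurable_fading k)
    (hnet.measurable_band k)

variable [IsProbabilityMeasure P]

/-- The conditional success probability given the locations. -/
lemma IsNetwork.condSuccess_ae_eq (hnet : IsNetwork P lam X h S) (hN : N ≠ 0)
    (hθ : 0 < θ) (hr₀ : 0 < r₀) (k : ℕ) :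
    condSuccess P α θ r₀ W N₀ X h S k =ᵐ[P]
      fun ω => (successProb N α θ r₀ W N₀ fun i => X i ω).toReal :=
  condExp_indicator_of_indepFun (G := {z | k ∈ slotsOf α θ r₀ W N₀ z}) hnet.measurable_locations
    hnet.measurable_marks hnet.locations_indep (measurableSet_slotsOf k)
    fun x => hnet.measure_success hN hθ hr₀ x k

/-- The conditional joint distribution of the delays till success given the locations. -/
lemma IsNetwork.condExp_delays_ae_eq (hnet : IsNetwork P lam X h S) (hN : N ≠ 0)
    (hθ : 0 < θ) (hr₀ : 0 < r₀) (n : Fin N → ℕ) :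
    P⟦{ω | ∀ i : Fin N, delayTillSuccess α θ r₀ W N₀ X h S i ω = (n i + 1 : ℕ)} |
      locationsSigma X⟧ =ᵐ[P] fun ω => (∏ i : Fin N,
        (1 - successProb N α θ r₀ W N₀ fun i => X i ω) ^ n i *
          successProb N α θ r₀ W N₀ fun i => X i ω).toReal := by
  refine condExp_indicator_of_indepFun (G := {z | ∀ i : Fin N,
    slotsUntil (slotsOf α θ r₀ W N₀ z) (i + 1) - slotsUntil (slotsOf α θ r₀ W N₀ z) i =
      (n i + 1 : ℕ)}) (q := fun x => ∏ i : Fin N, (1 - successProb N α θ r₀ W N₀ x) ^ n i *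
        successProb N α θ r₀ W N₀ x) hnet.measurable_locations
    hnet.measurable_marks hnet.locations_indep ?_ fun x => ?_
  · have : {z : (ℕ → EuclideanSpace ℝ (Fin d)) × (ℕ × Option ℕ → ℝ × Fin N) | ∀ i : Fin N,
        slotsUntil (slotsOf α θ r₀ W N₀ z) (i + 1) - slotsUntil (slotsOf α θ r₀ W N₀ z) i =
        (n i + 1 : ℕ)} = ⋂ i : Fin N, {z | slotsUntil (slotsOf α θ r₀ W N₀ z) (i + 1) -
          slotsUntil (slotsOf α θ r₀ W N₀ z) i = (n i + 1 : ℕ)} := by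
      ext z; simp
    rw [this]
    refine MeasurableSet.iInter fun i => ?_
    exact (measurable_of_countable fun y : ℕ∞ × ℕ∞ => y.1 - y.2).comp
      ((measurable_slotsUntil measurableSet_slotsOf _).prodMk
        (measurable_slotsUntil measurableSet_slotsOf _)) (measurableSet_singleton _)
  · have h1 := measure_waiting_times (hnet.measurableSet_success_const x)
      (hnet.iIndepSet_success x) (hnet.measure_success (α := α) (W := W) (N₀ := N₀) hN hθ hr₀ x) N
      -- The values beyond `N` are immaterial, as only the first `N` waiting times are prescribed.
      (fun i => if hi : i < N then n ⟨i, hi⟩ else 0)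
    rw [Finset.prod_range] at h1
    simp only [Fin.is_lt, dite_true, Fin.eta] at h1
    rw [← h1]
    congr 1
    ext ω
    constructor
    · intro hω i hi
      have := hω ⟨i, hi⟩
      simp only [hi, dite_true]
      exact this
    · intro hω i
      have := hω i i.2
      simp only [i.2, dite_true] at this
      exact this

lemma inv_successProb_pow (j : ℕ) (x : ℕ → EuclideanSpace ℝ (Fin d)) :
    (successProb N α θ r₀ W N₀ x)⁻¹ ^ j =
      expE (j * ENNReal.ofReal (paramB α θ r₀ W N₀ / N)) *
        expE (∑' i, j * logE (bandLaplace N (θ * r₀ ^ α) α (x i))⁻¹) := by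
  rw [successProb, inv_inv, ← expE_nat_mul, mul_add, expE_add, ENNReal.tsum_mul_left]

/-- The exponential functional of the Poisson process applied to `g = j * log (1/v)`, for which
`expE g = v⁻ʲ`. -/
lemma IsNetwork.lintegral_inv_successProb_pow (hnet : IsNetwork P lam X h S) (hN : N ≠ 0)
    (hlam : 0 < lam) (j : ℕ) :
    ∫⁻ ω, (successProb N α θ r₀ W N₀ fun i => X i ω)⁻¹ ^ j ∂P =
      expE (j * ENNReal.ofReal (paramB α θ r₀ W N₀ / N)) *
        expE (ENNReal.ofReal lam * ∫⁻ x : EuclideanSpace ℝ (Fin d),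
          ((bandLaplace N (θ * r₀ ^ α) α x)⁻¹ ^ j - 1)) := by
  have hg : Measurable fun x : EuclideanSpace ℝ (Fin d) =>
      (j : ℝ≥0∞) * logE (bandLaplace N (θ * r₀ ^ α) α x)⁻¹ :=
    (measurable_logE.comp (measurable_bandLaplace N _ α).inv).const_mul _
  simp_rw [inv_successProb_pow]
  rw [lintegral_const_mul' _ _ (by simp [ENNReal.mul_eq_top]),
    hnet.isPoissonProcess.lintegral_expE_tsum hlam.le hg]
  congr 3
  refine lintegral_congr fun x => ?_
  rw [expE_nat_mul, expE_logE]
  rw [ENNReal.one_le_inv]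
  exact bandLaplace_le_one (Nat.one_le_iff_ne_zero.2 hN) _ _ _

end Network

/-! ### Moments of the local delay -/

section Moments

variable {Ω : Type*} [MeasurableSpace Ω] {P : Measure Ω} {d N : ℕ} {lam α θ r₀ W N₀ : ℝ}
  {X : ℕ → Ω → EuclideanSpace ℝ (Fin d)} {h : ℕ → Option ℕ → Ω → ℝ}
  {S : ℕ → Option ℕ → Ω → Fin N}

lemma IsNetwork.measurable_localDelay (hnet : IsNetwork P lam X h S) :
    Measurable (localDelay α θ r₀ W N₀ X h S) :=
  measurable_slotsUntil (fun k => FHMA.measurableSet_success hnet.isPoissonProcess.measurable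
    (hnet.measurable_fading k) (hnet.measurable_band k)) N

lemma successProb_le_one (x : ℕ → EuclideanSpace ℝ (Fin d)) :
    successProb N α θ r₀ W N₀ x ≤ 1 :=
  ENNReal.inv_le_one.2 (one_le_expE _)

lemma paramA_nonneg (hlam : 0 < lam) (hα : (d : ℝ) < α) (hθ : 0 < θ) (hr₀ : 0 < r₀) :
    0 ≤ paramA d lam α θ r₀ := by
  have hd0 : (0 : ℝ) ≤ d := Nat.cast_nonneg d
  have hα0 : 0 < α := hd0.trans_lt hα
  have hδ0 : 0 ≤ (d : ℝ) / α := by positivity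
  have hδ1 : (d : ℝ) / α < 1 := (div_lt_one hα0).2 hα
  have hsinc : 0 ≤ Real.sinc (Real.pi * (d / α)) := by
    rcases hδ0.eq_or_lt with h0 | h0
    · rw [← h0]; simp
    · rw [Real.sinc_of_ne_zero (by positivity)]
      exact div_nonneg (Real.sin_nonneg_of_nonneg_of_le_pi (by positivity)
        (by nlinarith [Real.pi_pos])) (by positivity)
  unfold paramA
  positivity

/-- Since `α δ = d`, the factor `c^δ` of the space integrals is `θ^δ r₀^d`. -/
lemma paramA_eq (hθ : 0 < θ) (hr₀ : 0 < r₀) (hα : (d : ℝ) < α) :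
    paramA d lam α θ r₀ = lam * (volume.real (Metric.ball (0 : EuclideanSpace ℝ (Fin d)) 1) *
      (θ * r₀ ^ α) ^ ((d : ℝ) / α) * (1 / Real.sinc (Real.pi * (d / α)))) := by
  have hα0 : 0 < α := (Nat.cast_nonneg d).trans_lt hα
  rw [paramA, Real.mul_rpow hθ.le (by positivity), ← Real.rpow_mul hr₀.le,
    mul_div_cancel₀ _ hα0.ne', Real.rpow_natCast]
  ring

variable [IsProbabilityMeasure P]

/-- The mean of the reciprocal of the conditional success probability. -/
lemma IsNetwork.lintegral_inv_successProb (hnet : IsNetwork P lam X h S) (hd : 1 ≤ d) (hN : 2 ≤ N)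
    (hlam : 0 < lam) (hα : (d : ℝ) < α) (hθ : 0 < θ) (hr₀ : 0 < r₀) (hW : 0 < W) (hN₀ : 0 ≤ N₀) :
    ∫⁻ ω, (successProb N α θ r₀ W N₀ fun i => X i ω)⁻¹ ∂P =
      ENNReal.ofReal (Real.exp (paramA d lam α θ r₀ /
        (((N : ℝ) - 1) ^ (1 - d / α) * (N : ℝ) ^ (d / α)) + paramB α θ r₀ W N₀ / N)) := by
  have hN' : (2 : ℝ) ≤ N := by exact_mod_cast hN
  have hN1 : (0 : ℝ) < N - 1 := by linarith
  have hA := paramA_nonneg hlam hα hθ hr₀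
  have hB : 0 ≤ paramB α θ r₀ W N₀ := by unfold paramB; positivity
  have h1 := hnet.lintegral_inv_successProb_pow (α := α) (θ := θ) (r₀ := r₀) (W := W) (N₀ := N₀)
    (by omega) hlam 1
  rw [lintegral_inv_bandLaplace_sub_one hd hN (by positivity) hα, ← ENNReal.ofReal_mul hlam.le,
    ← mul_div_assoc, ← paramA_eq hθ hr₀ hα, Nat.cast_one, one_mul, expE_ofReal (by positivity),
    expE_ofReal (by positivity), ← ENNReal.ofReal_mul (by positivity), ← Real.exp_add,
    add_comm] at h1
  simpa using h1

/-- The mean of the squared reciprocal of the conditional success probability. -/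
lemma IsNetwork.lintegral_inv_successProb_sq (hnet : IsNetwork P lam X h S) (hd : 1 ≤ d)
    (hN : 2 ≤ N) (hlam : 0 < lam) (hα : (d : ℝ) < α) (hθ : 0 < θ) (hr₀ : 0 < r₀) (hW : 0 < W)
    (hN₀ : 0 ≤ N₀) :
    ∫⁻ ω, (successProb N α θ r₀ W N₀ fun i => X i ω)⁻¹ ^ 2 ∂P =
      ENNReal.ofReal (Real.exp ((2 * (N : ℝ) - 1 - d / α) * paramA d lam α θ r₀ /
        ((N : ℝ) ^ (d / α) * ((N : ℝ) - 1) ^ (2 - d / α)) +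
        2 * paramB α θ r₀ W N₀ / N)) := by
  have hN' : (2 : ℝ) ≤ N := by exact_mod_cast hN
  have hN1 : (0 : ℝ) < N - 1 := by linarith
  have hα0 : 0 < α := (Nat.cast_nonneg d).trans_lt hα
  have hδ1 : (d : ℝ) / α < 1 := (div_lt_one hα0).2 hα
  have hδ2 : 0 < 2 * (N : ℝ) - 1 - d / α := by linarith
  have hA := paramA_nonneg hlam hα hθ hr₀
  have hB : 0 ≤ paramB α θ r₀ W N₀ := by unfold paramB; positivity
  have h2 : ENNReal.ofReal 2 = ((2 : ℕ) : ℝ≥0∞) := by simp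
  have h1 := hnet.lintegral_inv_successProb_pow (α := α) (θ := θ) (r₀ := r₀) (W := W) (N₀ := N₀)
    (by omega) hlam 2
  rw [lintegral_inv_sq_bandLaplace_sub_one hd hN (by positivity) hα, ← ENNReal.ofReal_mul hlam.le,
    ← mul_div_assoc, mul_left_comm, ← paramA_eq hθ hr₀ hα, ← h2,
    ← ENNReal.ofReal_mul zero_le_two, expE_ofReal (by positivity),
    expE_ofReal (by positivity), ← ENNReal.ofReal_mul (by positivity), ← Real.exp_add,
    add_comm, ← mul_div_assoc] at h1
  exact h1

/-- A function with finite integral is almost surely finite, here `p⁻¹`. -/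
lemma IsNetwork.ae_successProb_ne_zero (hnet : IsNetwork P lam X h S) (hd : 1 ≤ d)
    (hN : 2 ≤ N) (hlam : 0 < lam) (hα : (d : ℝ) < α) (hθ : 0 < θ) (hr₀ : 0 < r₀) (hW : 0 < W)
    (hN₀ : 0 ≤ N₀) : ∀ᵐ ω ∂P, successProb N α θ r₀ W N₀ (fun i => X i ω) ≠ 0 := by
  have hm : Measurable fun ω => (successProb N α θ r₀ W N₀ fun i => X i ω)⁻¹ := by
    simp_rw [successProb, inv_inv]
    have hs : Measurable fun ω =>
        ∑' i, logE (bandLaplace N (θ * r₀ ^ α) α (X i ω))⁻¹ := Measurable.tsum fun i =>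
      measurable_logE.comp
        (((measurable_bandLaplace N _ α).comp (hnet.isPoissonProcess.measurable i)).inv)
    exact measurable_expE.comp (hs.const_add _)
  filter_upwards [ae_lt_top hm (by
    rw [hnet.lintegral_inv_successProb hd hN hlam hα hθ hr₀ hW hN₀]
    exact ENNReal.ofReal_ne_top)] with ω hω
  exact ENNReal.inv_ne_top.1 hω.ne

/-- Fubini for locations and marks: the inner integral sees frozen locations, where the trials are
independent. -/
lemma IsNetwork.lintegral_fun_localDelay (hnet : IsNetwork P lam X h S) (F : ℕ∞ → ℝ≥0∞) :
    ∫⁻ ω, F (localDelay α θ r₀ W N₀ X h S ω) ∂P = ∫⁻ ω, ∫⁻ ω',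
      F (slotsUntil (successSlots α θ r₀ W N₀ (fun i _ => X i ω) h S ω') N) ∂P ∂P :=
  lintegral_prodMk_of_indepFun (f := fun z => F (slotsUntil (slotsOf α θ r₀ W N₀ z) N))
    hnet.measurable_locations hnet.measurable_marks hnet.locations_indep
    ((measurable_of_countable F).comp (measurable_slotsUntil measurableSet_slotsOf N))

/-- The mean of the local delay. -/
lemma IsNetwork.lintegral_localDelay (hnet : IsNetwork P lam X h S) (hd : 1 ≤ d)
    (hN : 2 ≤ N) (hlam : 0 < lam) (hα : (d : ℝ) < α) (hθ : 0 < θ) (hr₀ : 0 < r₀) (hW : 0 < W)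
    (hN₀ : 0 ≤ N₀) :
    ∫⁻ ω, (localDelay α θ r₀ W N₀ X h S ω : ℝ≥0∞) ∂P =
      ENNReal.ofReal (meanFormula d N lam α θ r₀ W N₀) := by
  have hN0 : N ≠ 0 := by omega
  rw [hnet.lintegral_fun_localDelay fun n => (n : ℝ≥0∞)]
  have h1 : ∀ᵐ ω ∂P, ∫⁻ ω', (slotsUntil (successSlots α θ r₀ W N₀ (fun i _ => X i ω) h S ω') N :
      ℝ≥0∞) ∂P = N * (successProb N α θ r₀ W N₀ fun i => X i ω)⁻¹ := by
    filter_upwards [hnet.ae_successProb_ne_zero hd hN hlam hα hθ hr₀ hW hN₀] with ω hω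
    -- The moment formula is indexed by `k + 1` successes, hence `k = N - 1`.
    have := lintegral_slotsUntil (hnet.measurableSet_success_const fun i => X i ω)
      (hnet.iIndepSet_success _) (hnet.measure_success hN0 hθ hr₀ _) hω (N - 1)
    rwa [Nat.sub_add_cancel (by omega)] at this
  rw [lintegral_congr_ae h1, lintegral_const_mul' _ _ (ENNReal.natCast_ne_top N),
    hnet.lintegral_inv_successProb hd hN hlam hα hθ hr₀ hW hN₀, meanFormula,
    ENNReal.ofReal_mul (Nat.cast_nonneg N), ENNReal.ofReal_natCast]

/-- The second factorial moment of the local delay. -/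
lemma IsNetwork.lintegral_localDelay_mul_add_one (hnet : IsNetwork P lam X h S) (hd : 1 ≤ d)
    (hN : 2 ≤ N) (hlam : 0 < lam) (hα : (d : ℝ) < α) (hθ : 0 < θ) (hr₀ : 0 < r₀) (hW : 0 < W)
    (hN₀ : 0 ≤ N₀) :
    ∫⁻ ω, (localDelay α θ r₀ W N₀ X h S ω : ℝ≥0∞) *
        ((localDelay α θ r₀ W N₀ X h S ω : ℝ≥0∞) + 1) ∂P =
      ENNReal.ofReal (N * ((N : ℝ) + 1) *
        Real.exp ((2 * (N : ℝ) - 1 - d / α) * paramA d lam α θ r₀ /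
          ((N : ℝ) ^ (d / α) * ((N : ℝ) - 1) ^ (2 - d / α)) +
          2 * paramB α θ r₀ W N₀ / N)) := by
  have hN0 : N ≠ 0 := by omega
  rw [hnet.lintegral_fun_localDelay fun n => (n : ℝ≥0∞) * ((n : ℝ≥0∞) + 1)]
  have h1 : ∀ᵐ ω ∂P, ∫⁻ ω',
      (slotsUntil (successSlots α θ r₀ W N₀ (fun i _ => X i ω) h S ω') N : ℝ≥0∞) *
      ((slotsUntil (successSlots α θ r₀ W N₀ (fun i _ => X i ω) h S ω') N : ℝ≥0∞) + 1) ∂P =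
      (N * (N + 1) : ℕ) * (successProb N α θ r₀ W N₀ fun i => X i ω)⁻¹ ^ 2 := by
    filter_upwards [hnet.ae_successProb_ne_zero hd hN hlam hα hθ hr₀ hW hN₀] with ω hω
    have := lintegral_slotsUntil_mul_add_one (hnet.measurableSet_success_const fun i => X i ω)
      (hnet.iIndepSet_success _) (hnet.measure_success hN0 hθ hr₀ _) hω (N - 1)
    rwa [show N - 1 + 2 = N + 1 by omega, Nat.sub_add_cancel (by omega)] at this
  rw [lintegral_congr_ae h1, lintegral_const_mul' _ _ (ENNReal.natCast_ne_top _),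
    hnet.lintegral_inv_successProb_sq hd hN hlam hα hθ hr₀ hW hN₀,
    ENNReal.ofReal_mul (by positivity), ← ENNReal.ofReal_natCast]
  push_cast
  rfl

end Moments

/-- The first two moments of an almost surely finite `ℕ∞`-valued random variable, from its mean
and its second factorial moment. -/
lemma moments_toNat {Ω : Type*} [MeasurableSpace Ω] {P : Measure Ω} [IsProbabilityMeasure P]
    {L : Ω → ℕ∞} (hL : Measurable L) {a b : ℝ} (ha : 0 ≤ a) (hb : 0 ≤ b)
    (h1 : ∫⁻ ω, (L ω : ℝ≥0∞) ∂P = ENNReal.ofReal a)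
    (h2 : ∫⁻ ω, (L ω : ℝ≥0∞) * ((L ω : ℝ≥0∞) + 1) ∂P = ENNReal.ofReal b) :
    (∀ᵐ ω ∂P, L ω ≠ ⊤) ∧ MemLp (fun ω => ((L ω).toNat : ℝ)) 2 P ∧
      ∫ ω, ((L ω).toNat : ℝ) ∂P = a ∧ variance (fun ω => ((L ω).toNat : ℝ)) P = b - a - a ^ 2 := by
  have htop : ∀ᵐ ω ∂P, L ω ≠ ⊤ := by
    filter_upwards [ae_lt_top ((measurable_of_countable fun n : ℕ∞ => (n : ℝ≥0∞)).comp hL)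
      (by simp only [Function.comp_apply]; rw [h1]; exact ENNReal.ofReal_ne_top)] with ω hω
    simpa using hω.ne
  have hf : Measurable fun ω => ((L ω).toNat : ℝ) :=
    (measurable_of_countable fun n : ℕ∞ => (n.toNat : ℝ)).comp hL
  have hcast : ∀ᵐ ω ∂P, (L ω : ℝ≥0∞) = ENNReal.ofReal ((L ω).toNat : ℝ) := by
    filter_upwards [htop] with ω hω
    rw [ENNReal.ofReal_natCast, ← ENat.toENNReal_coe, ENat.natCast_toNat hω]
  have e1 : ∫⁻ ω, ENNReal.ofReal ((L ω).toNat : ℝ) ∂P = ENNReal.ofReal a := by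
    rw [← h1]
    exact lintegral_congr_ae (hcast.mono fun ω hω => hω.symm)
  have e2 : ∫⁻ ω, ENNReal.ofReal (((L ω).toNat : ℝ) * (((L ω).toNat : ℝ) + 1)) ∂P =
      ENNReal.ofReal b := by
    rw [← h2]
    refine lintegral_congr_ae (hcast.mono fun ω hω => ?_)
    simp only
    rw [hω, ENNReal.ofReal_mul (by positivity), ENNReal.ofReal_add (by positivity) zero_le_one,
      ENNReal.ofReal_one]
  have hg : Measurable fun ω => ((L ω).toNat : ℝ) * (((L ω).toNat : ℝ) + 1) :=
    hf.mul (hf.add_const 1)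
  have i1 : Integrable (fun ω => ((L ω).toNat : ℝ)) P :=
    lintegral_ofReal_ne_top_iff_integrable hf.aestronglyMeasurable
      (Filter.Eventually.of_forall fun ω => Nat.cast_nonneg _) |>.1 (by
        rw [e1]; exact ENNReal.ofReal_ne_top)
  have i2 : Integrable (fun ω => ((L ω).toNat : ℝ) * (((L ω).toNat : ℝ) + 1)) P :=
    lintegral_ofReal_ne_top_iff_integrable hg.aestronglyMeasurable
      (Filter.Eventually.of_forall fun ω => by positivity) |>.1 (by
        rw [e2]; exact ENNReal.ofReal_ne_top)
  have v1 : ∫ ω, ((L ω).toNat : ℝ) ∂P = a := by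
    rw [integral_eq_lintegral_of_nonneg_ae (Filter.Eventually.of_forall fun ω => Nat.cast_nonneg _)
      hf.aestronglyMeasurable, e1, ENNReal.toReal_ofReal ha]
  have v2 : ∫ ω, ((L ω).toNat : ℝ) * (((L ω).toNat : ℝ) + 1) ∂P = b := by
    rw [integral_eq_lintegral_of_nonneg_ae (Filter.Eventually.of_forall fun ω => by positivity)
      hg.aestronglyMeasurable, e2, ENNReal.toReal_ofReal hb]
  -- From `L² = L(L+1) - L` the second moment is `b - a`.
  have hsq : (fun ω => ((L ω).toNat : ℝ) ^ 2) =
      fun ω => ((L ω).toNat : ℝ) * (((L ω).toNat : ℝ) + 1) - ((L ω).toNat : ℝ) := by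
    ext ω; ring
  have hmem : MemLp (fun ω => ((L ω).toNat : ℝ)) 2 P := by
    rw [memLp_two_iff_integrable_sq hf.aestronglyMeasurable, hsq]
    exact i2.sub i1
  refine ⟨htop, hmem, v1, ?_⟩
  rw [variance_eq_sub hmem, v1]
  have : ∫ ω, ((fun ω => ((L ω).toNat : ℝ)) ^ 2) ω ∂P = b - a := by
    change ∫ ω, (fun ω => ((L ω).toNat : ℝ) ^ 2) ω ∂P = b - a
    rw [hsq, integral_sub i2 i1, v1, v2]
  rw [this]

end FHMA

/-- Variance of the local delay in FHMA with `N` sub-bands. -/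
theorem theorem2 {Ω : Type*} [MeasurableSpace Ω] (P : Measure Ω) [IsProbabilityMeasure P]
    (d N : ℕ) (hd : 1 ≤ d) (hN : 2 ≤ N)
    (lam α θ W N₀ : ℝ) (hlam : 0 < lam) (hα : (d : ℝ) < α) (hθ : 0 < θ) (hW : 0 < W)
    (hN₀ : 0 ≤ N₀)
    (x₀ : EuclideanSpace ℝ (Fin d)) (hx₀ : x₀ ≠ 0)
    (X : ℕ → Ω → EuclideanSpace ℝ (Fin d)) (h : ℕ → Option ℕ → Ω → ℝ)
    (S : ℕ → Option ℕ → Ω → Fin N) (hnet : FHMA.IsNetwork P lam X h S) :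
    -- the local delay is the sum of `N` delays till success
    (∀ ω, FHMA.localDelay α θ ‖x₀‖ W N₀ X h S ω =
      ∑ i ∈ Finset.range N, FHMA.delayTillSuccess α θ ‖x₀‖ W N₀ X h S i ω) ∧
    -- the conditional success probability is positive, and, given the locations of the
    -- transmitters, the delays till success are i.i.d. geometric with that parameter
    (∀ k, ∀ᵐ ω ∂P, 0 < FHMA.condSuccess P α θ ‖x₀‖ W N₀ X h S k ω) ∧
    (∀ (k : ℕ) (n : Fin N → ℕ),
      P⟦{ω | ∀ i : Fin N, FHMA.delayTillSuccess α θ ‖x₀‖ W N₀ X h S i ω = (n i + 1 : ℕ)} |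
          FHMA.locationsSigma X⟧ =ᵐ[P]
        fun ω => ∏ i : Fin N, (1 - FHMA.condSuccess P α θ ‖x₀‖ W N₀ X h S k ω) ^ n i *
          FHMA.condSuccess P α θ ‖x₀‖ W N₀ X h S k ω) ∧
    -- the local delay is almost surely finite and square integrable, with mean `D(N)` and
    -- variance `V(N)`
    (∀ᵐ ω ∂P, FHMA.localDelay α θ ‖x₀‖ W N₀ X h S ω ≠ ⊤) ∧
    MemLp (fun ω => ((FHMA.localDelay α θ ‖x₀‖ W N₀ X h S ω).toNat : ℝ)) 2 P ∧
    ∫ ω, ((FHMA.localDelay α θ ‖x₀‖ W N₀ X h S ω).toNat : ℝ) ∂P =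
      FHMA.meanFormula d N lam α θ ‖x₀‖ W N₀ ∧
    variance (fun ω => ((FHMA.localDelay α θ ‖x₀‖ W N₀ X h S ω).toNat : ℝ)) P =
      FHMA.varFormula d N lam α θ ‖x₀‖ W N₀ := by
  have hr₀ : 0 < ‖x₀‖ := norm_pos_iff.2 hx₀
  have hN0 : N ≠ 0 := by omega
  have hp1 : ∀ ω, FHMA.successProb N α θ ‖x₀‖ W N₀ (fun i => X i ω) ≠ ⊤ := fun ω =>
    ne_top_of_le_ne_top ENNReal.one_ne_top (FHMA.successProb_le_one _)
  refine ⟨fun ω => FHMA.slotsUntil_eq_sum _ N, fun k => ?_, fun k n => ?_, ?_⟩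
  · filter_upwards [hnet.condSuccess_ae_eq (α := α) (W := W) (N₀ := N₀) hN0 hθ hr₀ k,
      hnet.ae_successProb_ne_zero hd hN hlam hα hθ hr₀ hW hN₀] with ω h1 h2
    rw [h1]
    exact ENNReal.toReal_pos h2 (hp1 ω)
  · filter_upwards [hnet.condSuccess_ae_eq (α := α) (W := W) (N₀ := N₀) hN0 hθ hr₀ k,
      hnet.condExp_delays_ae_eq (α := α) (W := W) (N₀ := N₀) hN0 hθ hr₀ n] with ω h1 h2
    -- The right side of `h1` does not involve `k`, so the conditional success probability of any
    -- slot can serve as the parameter.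
    rw [h2, h1, ENNReal.toReal_prod]
    refine Finset.prod_congr rfl fun i _ => ?_
    rw [ENNReal.toReal_mul, ENNReal.toReal_pow,
      ENNReal.toReal_sub_of_le (FHMA.successProb_le_one _) ENNReal.one_ne_top, ENNReal.toReal_one]
  · have hD : 0 ≤ FHMA.meanFormula d N lam α θ ‖x₀‖ W N₀ := by
      unfold FHMA.meanFormula
      positivity
    exact FHMA.moments_toNat hnet.measurable_localDelay hD (by positivity)
      (hnet.lintegral_localDelay hd hN hlam hα hθ hr₀ hW hN₀)
      (hnet.lintegral_localDelay_mul_add_one hd hN hlam hα hθ hr₀ hW hN₀)
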